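/- Model (MPC). There are $m$ machines, each a randomized word RAM with words of $O(\log n)$ bits, unit-cost word operations and its own independent uniform random words. Computation proceeds in synchronous rounds. In each round every machine runs a local program on its memory and on the words it received; between rounds the words sent are delivered. The space used by a machine is the number of words of memory, of received data, of sent data and of output that it uses, so no machine sends or receives more data than its memory size. An algorithm is a fixed finite sequence of programs, one per round, which is the same for all $n$, $m$, inputs and machines. Input. The input is a rooted tree $T$ with $n$ vertices numbered $1,\dots,n$. Its vertices are distributed arbitrarily over the $m$ machines, each vertex on exactly one machine, stored as the pair of its index and the index of its parent. It is assumed that $m \ge n^{\delta}$ for a constant $0<\delta<1$, and that both $m$ and the number of vertices initially held by any machine are at most $C_0\,\frac nm\,(\log n)^{K_0}$ for constants $C_0, K_0$. Theorem. There is a randomized MPC algorithm with a constant number $R$ of rounds and a constant $a$ such that for all $C_0,K_0$ there are constants $C,K$ and a memory size $S(n,m)\le C\,\frac nm\,(\log n)^{K}$ (that is, $S=\tilde O(n/m)$) for which the following holds. For all $0<\delta<1$ and every $c\in\mathbb N$ there is $n_0$ such that, for all $n\ge n_0$, all $m$ and all inputs as above: 1. for every outcome of the random words, the algorithm halts after $R$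 rounds and has output the pairs $(v,\deg_T v)$, the pair of each vertex $v$ being output exactly once, by one of the machines; 2. with probability at least $1-n^{-c}$, in every round every machine uses space at most $S(n,m)$ and runs for at most $a\,S(n,m)$ steps, i.e. for time linear in its memory size. -/

import Mathlib

/-! ## Rooted trees -/

/-- A rooted tree on `n` numbered vertices, given by its parent pointers.  The root is stored as its own
parent, and following parent pointers from any vertex leads to the root. -/
structure NumberedTree (n : ℕ) where
  root : Fin n
  parent : Fin n → Fin n
  parent_root : parent root = root
  reaches_root : ∀ v, ∃ k : ℕ, parent^[k] v = root

namespace NumberedTree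

variable {n : ℕ}

/-- The underlying undirected graph: every non-root vertex is joined to its parent. -/
def graph (T : NumberedTree n) : SimpleGraph (Fin n) :=
  SimpleGraph.fromRel (fun u v => T.parent u = v)

/-- The degree of a vertex: the number of its neighbours in the underlying tree. -/
noncomputable def degree (T : NumberedTree n) (v : Fin n) : ℕ :=
  (T.graph.neighborSet v).ncard

/-- The vertices have indices `1, …, n`. -/
def index (v : Fin n) : ℕ := v.val + 1

/-- The index of the parent of `v`, with `0` (no vertex) if `v` is the root. -/
def parentIndex (T : NumberedTree n) (v : Fin n) : ℕ :=
  if v = T.root then 0 else index (T.parent v)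

end NumberedTree

/-! ## The machines: a randomized word RAM with a structured instruction set -/

namespace MPC

/-- Unit-cost word operations.  Comparisons return `1` for true and `0` for false. -/
inductive BinOp where
  | add | sub | mul | div | mod | lt | eq

/-- Subtraction is truncated at `0`; every result is reduced to a word by `Expr.eval`. -/
def BinOp.apply : BinOp → ℕ → ℕ → ℕ
  | .add, a, b => a + b
  | .sub, a, b => a - b
  | .mul, a, b => a * b
  | .div, a, b => a / b
  | .mod, a, b => a % b
  | .lt, a, b => if a < b then 1 else 0
  | .eq, a, b => if a = b then 1 else 0

/-- Expressions over constants, registers and the (read-only) inbox of the current round. -/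
inductive Expr where
  | const (k : ℕ)
  | reg (i : ℕ)
  | inLen
  | inGet (e : Expr)
  | bin (op : BinOp) (e₁ e₂ : Expr)

/-- What a machine is given in one round: the word length `w` in bits, the words in its inbox,
and its tape of random words. -/
structure Env where
  w : ℕ
  inbox : List ℕ
  tape : ℕ → ℕ

/-- The value of an expression.  All arithmetic is modulo `2 ^ w`, at every intermediate step. -/
def Expr.eval (env : Env) (reg : ℕ → ℕ) : Expr → ℕ
  | .const k => k % 2 ^ env.w
  | .reg i => reg i % 2 ^ env.w
  | .inLen => env.inbox.length % 2 ^ env.w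
  | .inGet e => env.inbox.getD (e.eval env reg) 0 % 2 ^ env.w
  | .bin op e₁ e₂ => op.apply (e₁.eval env reg) (e₂.eval env reg) % 2 ^ env.w

/-- The number of steps needed to evaluate an expression: one for each operation or operand. -/
def Expr.cost : Expr → ℕ
  | .const _ => 1
  | .reg _ => 1
  | .inLen => 1
  | .inGet e => e.cost + 1
  | .bin _ e₁ e₂ => e₁.cost + e₂.cost + 1

/-- The state of one machine.
* `reg`: the registers (a program can name only a constant number of them);
* `mem`: the memory, addressed by words;
* `peak`: the least `p` such that all memory accesses so far were to addresses below `p`;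
* `rnd`: the number of random words consumed so far;
* `outbox`: the messages (destination, word) sent in the current round;
* `output`: the words that have been output so far;
* `time`: the number of steps taken in the current round. -/
structure State where
  reg : ℕ → ℕ
  mem : ℕ → ℕ
  peak : ℕ
  rnd : ℕ
  outbox : List (ℕ × ℕ)
  output : List ℕ
  time : ℕ

/-- The basic instructions. -/
inductive Instr where
  | assign (r : ℕ) (e : Expr)
  | load (r : ℕ) (a : Expr)
  | store (a e : Expr)
  | rand (r : ℕ)
  | send (dst e : Expr)
  | emit (e : Expr)

def State.tick (s : State) (k : ℕ) : State := { s with time := s.time + k }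

/-- The effect and the cost of a basic instruction. -/
def Instr.step (env : Env) (s : State) : Instr → State
  | .assign r e =>
      { s with
        reg := Function.update s.reg r (e.eval env s.reg)
        time := s.time + e.cost + 1 }
  | .load r a =>
      { s with
        reg := Function.update s.reg r (s.mem (a.eval env s.reg))
        peak := max s.peak (a.eval env s.reg + 1)
        time := s.time + a.cost + 1 }
  | .store a e =>
      { s with
        mem := Function.update s.mem (a.eval env s.reg) (e.eval env s.reg)
        peak := max s.peak (a.eval env s.reg + 1)
        time := s.time + a.cost + e.cost + 1 }
  | .rand r =>
      { s with
        reg := Function.update s.reg r (env.tape s.rnd)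
        rnd := s.rnd + 1
        time := s.time + 1 }
  | .send dst e =>
      { s with
        outbox := s.outbox ++ [(dst.eval env s.reg, e.eval env s.reg)]
        time := s.time + dst.cost + e.cost + 1 }
  | .emit e =>
      { s with
        output := s.output ++ [e.eval env s.reg]
        time := s.time + e.cost + 1 }

/-- Programs: the same finite text for all input sizes. -/
inductive Prog where
  | skip
  | instr (i : Instr)
  | seq (p q : Prog)
  | ite (b : Expr) (p q : Prog)
  | while (b : Expr) (p : Prog)

/-- `Exec env p s t`: the program `p`, started in state `s`, halts in state `t`.
A test is true if its value is nonzero. -/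
inductive Exec (env : Env) : Prog → State → State → Prop
  | skip (s : State) : Exec env .skip s s
  | instr (i : Instr) (s : State) : Exec env (.instr i) s (i.step env s)
  | seq {p q : Prog} {s t u : State} :
      Exec env p s t → Exec env q t u → Exec env (.seq p q) s u
  | iteTrue {b : Expr} {p q : Prog} {s t : State} :
      b.eval env s.reg ≠ 0 → Exec env p (s.tick (b.cost + 1)) t → Exec env (.ite b p q) s t
  | iteFalse {b : Expr} {p q : Prog} {s t : State} :
      b.eval env s.reg = 0 → Exec env q (s.tick (b.cost + 1)) t → Exec env (.ite b p q) s t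
  | whileTrue {b : Expr} {p : Prog} {s t u : State} :
      b.eval env s.reg ≠ 0 → Exec env p (s.tick (b.cost + 1)) t →
      Exec env (.while b p) t u → Exec env (.while b p) s u
  | whileFalse {b : Expr} {p : Prog} {s : State} :
      b.eval env s.reg = 0 → Exec env (.while b p) s (s.tick (b.cost + 1))

/-- The execution of a program is determined by its initial state (and its random tape). -/
theorem Exec.deterministic {env : Env} {p : Prog} {s t t' : State}
    (h : Exec env p s t) (h' : Exec env p s t') : t = t' := by
  induction h generalizing t' with
  | skip s => cases h'; rfl
  | instr i s => cases h'; rfl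
  | seq _ _ ih₁ ih₂ =>
    cases h' with
    | seq a b => exact ih₂ (ih₁ a ▸ b)
  | iteTrue hb _ ih =>
    cases h' with
    | iteTrue _ a => exact ih a
    | iteFalse hb' _ => exact absurd hb' hb
  | iteFalse hb _ ih =>
    cases h' with
    | iteTrue hb' _ => exact absurd hb hb'
    | iteFalse _ a => exact ih a
  | whileTrue hb _ _ ih₁ ih₂ =>
    cases h' with
    | whileTrue _ a b => exact ih₂ (ih₁ a ▸ b)
    | whileFalse hb' => exact absurd hb' hb
  | whileFalse hb =>
    cases h' with
    | whileTrue hb' _ _ => exact absurd hb hb'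
    | whileFalse _ => rfl

/-! ## Rounds of communication -/

/-- The initial state of machine `μ`: registers `0`, `1`, `2` hold the number `n` of vertices, the
number `m` of machines and the machine's own number; everything else is blank. -/
def initState (n m : ℕ) (μ : Fin m) : State where
  reg := fun i => if i = 0 then n else if i = 1 then m else if i = 2 then μ.val else 0
  mem := fun _ => 0
  peak := 0
  rnd := 0
  outbox := []
  output := []
  time := 0

/-- At the start of a round, the outbox is empty and the step counter is zero; registers, memory
and output are kept. -/
def State.startRound (s : State) : State := { s with outbox := [], time := 0 }

/-- The words sent to machine `μ`, ordered by sender and then by the order of sending. -/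
def delivered {m : ℕ} (c : Fin m → State) (μ : Fin m) : List ℕ :=
  (List.finRange m).flatMap fun ν =>
    ((c ν).outbox.filter (fun x => x.1 = μ.val)).map Prod.snd

/-- The inbox of each machine in round `i` (counted from `0`), when `c i` is the configuration
after `i` rounds: the input in the first round, later the words sent in the previous round. -/
def inboxAt {m : ℕ} (input : Fin m → List ℕ) (c : ℕ → Fin m → State) : ℕ → Fin m → List ℕ
  | 0 => input
  | i + 1 => delivered (c (i + 1))

/-- Sample points: an infinite sequence of `w`-bit words for each of the `m` machines. -/
abbrev Tapes (m w : ℕ) : Type := Fin m × ℕ → Fin (2 ^ w)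

/-- All random words of all machines are independent and uniform. -/
noncomputable def coins (m w : ℕ) : MeasureTheory.Measure (Tapes m w) :=
  MeasureTheory.Measure.infinitePi fun _ => (PMF.uniformOfFintype (Fin (2 ^ w))).toMeasure

/-- `c` is the run of the `R`-round algorithm `A` (program `A i` is run by every machine in
round `i`) with `w`-bit words on the given input and random tapes: `c 0` is the initial
configuration and `c i` the configuration after `i` rounds. -/
def IsRun (n : ℕ) {m w R : ℕ} (A : Fin R → Prog) (input : Fin m → List ℕ) (ω : Tapes m w)
    (c : ℕ → Fin m → State) : Prop :=
  c 0 = initState n m ∧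
  ∀ (i : Fin R) (μ : Fin m),
    Exec ⟨w, inboxAt input c i.val μ, fun j => (ω (μ, j)).val⟩ (A i)
      (c i.val μ).startRound (c (i.val + 1) μ)

/-- The space, in words, used by machine `μ` in round `i` (together with all earlier rounds, as
far as memory and output are concerned): memory, received data, sent data and output. -/
def spaceUsed {m : ℕ} (input : Fin m → List ℕ) (c : ℕ → Fin m → State) (i : ℕ) (μ : Fin m) : ℕ :=
  (c (i + 1) μ).peak + (inboxAt input c i μ).length + (c (i + 1) μ).outbox.length
    + (c (i + 1) μ).output.length

/-- The number of steps of machine `μ` in round `i`. -/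
def timeUsed {m : ℕ} (c : ℕ → Fin m → State) (i : ℕ) (μ : Fin m) : ℕ := (c (i + 1) μ).time

/-- Every vertex is on exactly one list, exactly once. -/
def IsDistribution {n m : ℕ} (part : Fin m → List (Fin n)) : Prop :=
  ∀ v, ∑ μ, (part μ).count v = 1

/-- The input: the machines hold the vertices assigned to them, each as the pair of its index and
the index of its parent. -/
def treeInput {n m : ℕ} (T : NumberedTree n) (part : Fin m → List (Fin n)) (μ : Fin m) : List ℕ :=
  (part μ).flatMap fun v => [NumberedTree.index v, T.parentIndex v]

/-- The outputs consist of the index and the degree of every vertex, each vertex being reported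
exactly once, by one of the machines. -/
def OutputsDegrees {n m : ℕ} (T : NumberedTree n) (c : Fin m → State) : Prop :=
  ∃ part : Fin m → List (Fin n), IsDistribution part ∧
    ∀ μ, (c μ).output = (part μ).flatMap fun v => [NumberedTree.index v, T.degree v]

/-- Word length for inputs of size `n`: `κ (⌊log₂ n⌋ + 1)` bits. -/
def wordLength (κ n : ℕ) : ℕ := κ * (Nat.log 2 n + 1)

/-- The bound `C (n / m) (log n) ^ K`. -/
noncomputable def softBound (C : ℝ) (K n m : ℕ) : ℝ :=
  C * ((n : ℝ) / (m : ℝ)) * Real.log n ^ K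

end MPC

namespace MPC

set_option linter.unusedSimpArgs false

/-! The degree of `v` is the number of pairs (vertex, parent), over the non-root vertices, in which
`v` occurs (`degree_eq`, `occurrences_treeInput`). So it suffices to find the multiplicities in a
distributed multiset of `2 * n` keys from `0` to `n`, where `0` is a dummy that replaces the pair of
the root. A deterministic algorithm does this: no program draws a random word, and the exceptional
event is empty.

Cut the keys into blocks of `B = blockLength n m` consecutive values, where `B` is a multiple of `m`
with `3 * n < m * B` and `B ≤ 3 * n / m + m`. Two rounds tell every machine the number `W b` of keys
in each block. Block `b` then gets `W b / B + 1` consecutive machines. The weights sum to `2 * n`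
and at most `n / B + 1` blocks occur, so `m` machines suffice (`route_lt_machines`). Each sender
deals its keys of a block to the machines of the block in turn, so a machine receives at most its
share, which is at most `B`, plus one key per sender (`card_route_le`). A vertex of huge degree is
thereby spread over several machines.

Now every machine holds keys of a single block and counts them in a table of `B` entries. Entry `o`
goes to machine `o % m`. As `m` divides `B`, all partial counts of a key `v` meet at machine `v %
m`, which receives at most `B / m` words from each sender (`total_delivered`). All loads are `O(n /
m + m)` plus the input size, and `m` itself is assumed to be `Õ(n / m)`.

The programs are verified in exact arithmetic with side conditions excluding overflow; the loop
invariants carry the values together with the space and time bounds. -/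

/-! ### Word arithmetic without overflow. -/

/-- The number of different words. -/
def Env.size (env : Env) : ℕ := 2 ^ env.w

/-- Whether the exact result of an operation may exceed the word size. -/
def BinOp.Fits (N : ℕ) : BinOp → ℕ → ℕ → Prop
  | .add, a, b => a + b < N
  | .mul, a, b => a * b < N
  | _, _, _ => True

/-- The value of an expression in exact arithmetic. -/
def Expr.val (env : Env) (reg : ℕ → ℕ) : Expr → ℕ
  | .const k => k
  | .reg i => reg i
  | .inLen => env.inbox.length
  | .inGet e => env.inbox.getD (e.val env reg) 0
  | .bin op e₁ e₂ => op.apply (e₁.val env reg) (e₂.val env reg)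

/-- No intermediate result overflows. -/
def Expr.Fits (env : Env) (reg : ℕ → ℕ) : Expr → Prop
  | .const k => k < env.size
  | .reg i => reg i < env.size
  | .inLen => env.inbox.length < env.size
  | .inGet e => e.Fits env reg ∧ env.inbox.getD (e.val env reg) 0 < env.size
  | .bin op e₁ e₂ => e₁.Fits env reg ∧ e₂.Fits env reg ∧
      op.Fits env.size (e₁.val env reg) (e₂.val env reg)

/-- Only sums and products can leave the range: truncated subtraction, division and remainder do not
exceed the first operand, even for divisor `0`, and comparisons give at most `1`. -/
theorem BinOp.apply_lt {N : ℕ} (hN : 1 < N) (op : BinOp) {a b : ℕ} (ha : a < N)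
    (h : op.Fits N a b) : op.apply a b < N := by
  cases op <;> simp only [BinOp.Fits, BinOp.apply] at *
  · exact h
  · omega
  · exact h
  · exact (Nat.div_le_self a b).trans_lt ha
  · exact (Nat.mod_le a b).trans_lt ha
  · split_ifs <;> omega
  · split_ifs <;> omega

theorem Expr.val_lt {env : Env} (hN : 1 < env.size) {reg : ℕ → ℕ} {e : Expr}
    (h : e.Fits env reg) : e.val env reg < env.size := by
  induction e with
  | const k => exact h
  | reg i => exact h
  | inLen => exact h
  | inGet e _ => exact h.2
  | bin op e₁ e₂ ih₁ _ => exact op.apply_lt hN (ih₁ h.1) h.2.2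

theorem Expr.eval_eq_val {env : Env} (hN : 1 < env.size) {reg : ℕ → ℕ} {e : Expr}
    (h : e.Fits env reg) : e.eval env reg = e.val env reg := by
  induction e with
  | const k => exact Nat.mod_eq_of_lt h
  | reg i => exact Nat.mod_eq_of_lt h
  | inLen => exact Nat.mod_eq_of_lt h
  | inGet e ih =>
    simp only [Expr.eval, Expr.val, ih h.1]
    exact Nat.mod_eq_of_lt h.2
  | bin op e₁ e₂ ih₁ ih₂ =>
    simp only [Expr.eval, Expr.val, ih₁ h.1, ih₂ h.2.1]
    exact Nat.mod_eq_of_lt (Expr.val_lt hN (e := .bin op e₁ e₂) h)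

/-- The effect of a basic instruction in exact arithmetic. -/
def Instr.exact (env : Env) (s : State) : Instr → State
  | .assign r e =>
      { s with
        reg := Function.update s.reg r (e.val env s.reg)
        time := s.time + e.cost + 1 }
  | .load r a =>
      { s with
        reg := Function.update s.reg r (s.mem (a.val env s.reg))
        peak := max s.peak (a.val env s.reg + 1)
        time := s.time + a.cost + 1 }
  | .store a e =>
      { s with
        mem := Function.update s.mem (a.val env s.reg) (e.val env s.reg)
        peak := max s.peak (a.val env s.reg + 1)
        time := s.time + a.cost + e.cost + 1 }
  | .rand r =>
      { s with
        reg := Function.update s.reg r (env.tape s.rnd)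
        rnd := s.rnd + 1
        time := s.time + 1 }
  | .send dst e =>
      { s with
        outbox := s.outbox ++ [(dst.val env s.reg, e.val env s.reg)]
        time := s.time + dst.cost + e.cost + 1 }
  | .emit e =>
      { s with
        output := s.output ++ [e.val env s.reg]
        time := s.time + e.cost + 1 }

/-- No expression of the instruction overflows. -/
def Instr.Fits (env : Env) (s : State) : Instr → Prop
  | .assign _ e => e.Fits env s.reg
  | .load _ a => a.Fits env s.reg
  | .store a e => a.Fits env s.reg ∧ e.Fits env s.reg
  | .rand _ => True
  | .send dst e => dst.Fits env s.reg ∧ e.Fits env s.reg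
  | .emit e => e.Fits env s.reg

theorem Instr.step_eq_exact {env : Env} (hN : 1 < env.size) {s : State} {i : Instr}
    (h : i.Fits env s) : i.step env s = i.exact env s := by
  cases i <;> simp only [Instr.Fits] at h <;> simp only [Instr.step, Instr.exact]
  · rw [Expr.eval_eq_val hN h]
  · rw [Expr.eval_eq_val hN h]
  · rw [Expr.eval_eq_val hN h.1, Expr.eval_eq_val hN h.2]
  · rw [Expr.eval_eq_val hN h.1, Expr.eval_eq_val hN h.2]
  · rw [Expr.eval_eq_val hN h]

/-! ### Total correctness rules for programs. -/

/-- Total correctness: `p`, started in `s`, halts in a state satisfying `Q`. -/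
def WP (env : Env) (p : Prog) (Q : State → Prop) (s : State) : Prop :=
  ∃ t, Exec env p s t ∧ Q t

/-- A sequence of basic instructions. -/
def block : List Instr → Prog
  | [] => .skip
  | i :: l => .seq (.instr i) (block l)

/-- The condition under which a block runs without overflow and ends in a state satisfying `Q`. -/
def BlockWP (env : Env) : List Instr → (State → Prop) → State → Prop
  | [], Q, s => Q s
  | i :: l, Q, s => i.Fits env s ∧ BlockWP env l Q (i.exact env s)

theorem WP.seq {env : Env} {p q : Prog} {Q : State → Prop} {s : State}
    (h : WP env p (WP env q Q) s) : WP env (.seq p q) Q s := by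
  obtain ⟨t, ht, u, hu, hQ⟩ := h
  exact ⟨u, .seq ht hu, hQ⟩

theorem WP.block {env : Env} (hN : 1 < env.size) {l : List Instr} {Q : State → Prop} {s : State}
    (h : BlockWP env l Q s) : WP env (block l) Q s := by
  induction l generalizing s with
  | nil => exact ⟨s, .skip s, h⟩
  | cons i l ih =>
    refine .seq ⟨_, .instr i s, ?_⟩
    rw [Instr.step_eq_exact hN h.1]
    exact ih h.2

/-- `for c in 0, …, bound - 1 do body`. -/
def loop (c : ℕ) (bound : Expr) (body : Prog) : Prog :=
  .seq (.instr (.assign c (.const 0)))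
    (.while (.bin .lt (.reg c) bound)
      (.seq body (.instr (.assign c (.bin .add (.reg c) (.const 1))))))

/-- `Inv k` describes the state just before the test with counter value `k`. The bound may be an
expression in the registers, but the invariant must fix its value. The time charges are `2` for
initialising the counter, `bound.cost + 3` for each test and `4` for each increment. -/
theorem WP.loop {env : Env} (hN : 1 < env.size) {c : ℕ} {bound : Expr} {body : Prog}
    {Q : State → Prop} {s : State} (Inv : ℕ → State → Prop) (N : ℕ) (hNs : N < env.size)
    (h0 : Inv 0 { s with reg := Function.update s.reg c 0, time := s.time + 2 })
    (hreg : ∀ k t, Inv k t → t.reg c = k ∧ bound.Fits env t.reg ∧ bound.val env t.reg = N)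
    (hstep : ∀ k < N, ∀ t, Inv k t → WP env body (fun u => u.reg c = k ∧
      Inv (k + 1) { u with reg := Function.update u.reg c (k + 1), time := u.time + 4 })
      (t.tick (bound.cost + 3)))
    (hQ : ∀ t, Inv N t → Q (t.tick (bound.cost + 3))) : WP env (loop c bound body) Q s := by
  have cost : (Expr.bin .lt (.reg c) bound).cost + 1 = bound.cost + 3 := by
    simp only [Expr.cost]; omega
  have cond : ∀ k ≤ N, ∀ t, Inv k t →
      (Expr.bin .lt (.reg c) bound).eval env t.reg = if k < N then 1 else 0 := by
    intro k hk t ht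
    obtain ⟨h1, h2, h3⟩ := hreg k t ht
    have hc : t.reg c < env.size := by omega
    have hf : Expr.Fits env t.reg (.bin .lt (.reg c) bound) := ⟨hc, h2, trivial⟩
    rw [Expr.eval_eq_val hN hf]
    simp only [Expr.val, BinOp.apply, h1, h3]
  -- The induction is on the number `j` of iterations that remain.
  have main : ∀ j ≤ N, ∀ t, Inv (N - j) t → WP env (.while (.bin .lt (.reg c) bound)
      (.seq body (.instr (.assign c (.bin .add (.reg c) (.const 1)))))) Q t := by
    intro j
    induction j with
    | zero =>
      intro _ t ht
      have := cond N le_rfl t ht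
      rw [if_neg (lt_irrefl N)] at this
      exact ⟨_, .whileFalse this, cost ▸ hQ t ht⟩
    | succ j ih =>
      intro hj t ht
      have hc := cond _ (Nat.sub_le _ _) t ht
      have hlt : N - (j + 1) < N := by omega
      rw [if_pos hlt] at hc
      obtain ⟨u, hu, hu1, hu2⟩ := hstep _ hlt t ht
      have hsucc : N - (j + 1) + 1 = N - j := by omega
      have hfit : (Instr.assign c (.bin .add (.reg c) (.const 1))).Fits env u := by
        have h1 : u.reg c < env.size := by omega
        have h2 : u.reg c + 1 < env.size := by omega
        exact ⟨h1, hN, h2⟩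
      have hinc : Exec env (.instr (.assign c (.bin .add (.reg c) (.const 1)))) u
          { u with reg := Function.update u.reg c (N - j), time := u.time + 4 } := by
        convert Exec.instr _ u using 1
        rw [Instr.step_eq_exact hN hfit]
        simp only [Instr.exact, Expr.val, BinOp.apply, hu1, hsucc, Expr.cost]
      rw [hsucc] at hu2
      obtain ⟨v, hv, hQv⟩ := ih (by omega) _ hu2
      exact ⟨v, .whileTrue (by rw [hc]; decide) (.seq (cost ▸ hu) hinc) hv, hQv⟩
  refine .seq ⟨_, .instr _ s, ?_⟩
  have hfit : (Instr.assign c (.const 0)).Fits env s := (Nat.zero_lt_one.trans hN :)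
  rw [Instr.step_eq_exact hN hfit]
  exact main N le_rfl _ (by simpa [Instr.exact, Expr.val, Expr.cost] using h0)

theorem WP.ite {env : Env} (hN : 1 < env.size) {b : Expr} {p q : Prog} {Q : State → Prop}
    {s : State} (hb : b.Fits env s.reg)
    (ht : b.val env s.reg ≠ 0 → WP env p Q (s.tick (b.cost + 1)))
    (hf : b.val env s.reg = 0 → WP env q Q (s.tick (b.cost + 1))) : WP env (.ite b p q) Q s := by
  have he := Expr.eval_eq_val hN hb
  by_cases h : b.val env s.reg = 0
  · obtain ⟨t, h1, h2⟩ := hf h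
    exact ⟨t, .iteFalse (he.trans h) h1, h2⟩
  · obtain ⟨t, h1, h2⟩ := ht h
    exact ⟨t, .iteTrue (he ▸ h) h1, h2⟩

open Finset

/-! ### Arrays in memory and histograms. -/

/-- The arrays of a machine are interleaved in its memory: entry `i` of array `r`. -/
def arr (mem : ℕ → ℕ) (r i : ℕ) : ℕ := mem (8 * i + r)

theorem arr_update_same (mem : ℕ → ℕ) (r x v : ℕ) :
    arr (Function.update mem (8 * x + r) v) r = Function.update (arr mem r) x v := by
  funext i
  simp only [arr, Function.update_apply]
  congr 1
  simp

theorem arr_update_ne (mem : ℕ → ℕ) {r r' : ℕ} (h : r < 8) (h' : r' < 8) (hne : r' ≠ r) (x v : ℕ) :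
    arr (Function.update mem (8 * x + r) v) r' = arr mem r' := by
  funext i
  simp only [arr, Function.update_apply]
  rw [if_neg (by omega)]

/-- The contents of an array after adding `v i` to entry `a i` for all `i < k`. -/
def hist (k : ℕ) (a v : ℕ → ℕ) (b : ℕ) : ℕ := ∑ i ∈ range k, if a i = b then v i else 0

theorem hist_zero (a v : ℕ → ℕ) : hist 0 a v = fun _ => 0 := rfl

/-- The inductive step of every loop that builds a table of counts. -/
theorem update_hist (k : ℕ) (a v : ℕ → ℕ) :
    Function.update (hist k a v) (a k) (hist k a v (a k) + v k) = hist (k + 1) a v := by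
  funext b
  simp only [hist, Function.update_apply, sum_range_succ]
  by_cases h : b = a k
  · subst h; simp
  · rw [if_neg h, if_neg (Ne.symm h), add_zero]

theorem hist_le {k : ℕ} {a v : ℕ → ℕ} (hv : ∀ i, v i ≤ 1) (b : ℕ) : hist k a v b ≤ k := by
  refine (sum_le_sum (g := fun _ => 1) fun i _ => ?_).trans (by simp)
  split_ifs
  · exact hv i
  · exact zero_le_one

/-! ### Round one: counting keys by block. -/

/-- The registers with a fixed meaning: `n`, `m`, the machine's number, the block length and the
number of keys. -/
structure Std (n m μ B len : ℕ) (s : State) : Prop where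
  r0 : s.reg 0 = n
  r1 : s.reg 1 = m
  r2 : s.reg 2 = μ
  r3 : s.reg 3 = B
  r4 : s.reg 4 = len

/-- The block length. -/
def blockLength (n m : ℕ) : ℕ := m * (3 * n / (m * m) + 1)

/-- The `i`-th key of a machine with input `l`: a pair of a vertex and its parent contributes both
as keys, and the pair of the root and `0` contributes `0` twice. -/
def inputKey (l : List ℕ) (i : ℕ) : ℕ :=
  l.getD i 0 * (if 0 < l.getD (i / 2 * 2 + 1) 0 then 1 else 0)

theorem inputKey_le {l : List ℕ} {n : ℕ} (h : ∀ i, l.getD i 0 ≤ n) (i : ℕ) : inputKey l i ≤ n := by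
  unfold inputKey
  split_ifs
  · simpa using h i
  · simp

/-- Store the keys, count them by block, and send the count of block `b` to machine `b`. -/
def countProg : Prog :=
  .seq (block [.assign 3 (.bin .mul (.reg 1) (.bin .add (.bin .div (.bin .mul (.const 3) (.reg 0))
      (.bin .mul (.reg 1) (.reg 1))) (.const 1))), .assign 4 .inLen]) <|
  .seq (loop 5 (.reg 4) (block [
    .assign 6 (.bin .mul (.inGet (.reg 5)) (.bin .lt (.const 0) (.inGet (.bin .add
      (.bin .mul (.bin .div (.reg 5) (.const 2)) (.const 2)) (.const 1))))),
    .store (.bin .add (.bin .mul (.const 8) (.reg 5)) (.const 6)) (.reg 6),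
    .assign 7 (.bin .add (.bin .mul (.const 8) (.bin .div (.reg 6) (.reg 3))) (.const 1)),
    .load 8 (.reg 7),
    .store (.reg 7) (.bin .add (.reg 8) (.const 1))])) <|
  loop 5 (.reg 1) (block [
    .load 6 (.bin .add (.bin .mul (.const 8) (.reg 5)) (.const 1)),
    .send (.reg 5) (.reg 6)])

/-- What the first rounds keep: the keys in array `6`, and the arrays that are still blank. -/
structure Stored (n m μ B len : ℕ) (key : ℕ → ℕ) (P : ℕ) (s : State) : Prop where
  std : Std n m μ B len s
  keys : ∀ i < len, arr s.mem 6 i = key i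
  arr2 : arr s.mem 2 = fun _ => 0
  arr3 : arr s.mem 3 = fun _ => 0
  arr4 : arr s.mem 4 = fun _ => 0
  arr5 : arr s.mem 5 = fun _ => 0
  output : s.output = []
  peak : s.peak ≤ P

theorem countProg_spec {env : Env} {n m U : ℕ} (μ : Fin m)
    (hin : ∀ i, env.inbox.getD i 0 ≤ n) (hm : m ≤ U) (hlen : env.inbox.length ≤ U)
    (hB : blockLength n m ≤ U) (hnB : n < m * blockLength n m)
    (hU : 8 * U + 8 < env.size) (h3 : 3 * n < env.size) (hmm : m * m < env.size) :
    WP env countProg (fun s =>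
      Stored n m μ (blockLength n m) env.inbox.length (inputKey env.inbox) (8 * U + 8) s ∧
      s.outbox = (List.range m).map (fun b => (b, hist env.inbox.length
        (fun i => inputKey env.inbox i / blockLength n m) (fun _ => 1) b)) ∧
      s.time ≤ 100 * U + 100) (initState n m μ).startRound := by
  set B := blockLength n m with hBdef
  set len := env.inbox.length with hlendef
  have hN : 1 < env.size := by omega
  have hμ := μ.isLt
  have hBpos : 0 < B := by
    rcases Nat.eq_zero_or_pos B with h | h
    · rw [h] at hnB; omega
    · exact h
  have ht : 3 * n / (m * m) + 1 ≤ B := Nat.le_mul_of_pos_left _ (by omega)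
  have hkey := inputKey_le hin
  -- Since `n < m * B`, every block number is also the number of a machine.
  have hdiv : ∀ i, inputKey env.inbox i / B < m := fun i =>
    Nat.div_lt_of_lt_mul (by have := hkey i; rw [mul_comm] at hnB; omega)
  refine .seq (.block hN ?_)
  have hBs : m * (3 * n / (m * m) + 1) < env.size := by
    have : m * (3 * n / (m * m) + 1) = B := rfl
    omega
  simp only [BlockWP, Instr.Fits, Instr.exact, Expr.Fits, Expr.val, BinOp.Fits, BinOp.apply,
    State.startRound, initState, Expr.cost, reduceIte, Nat.reduceEqDiff, one_ne_zero, and_true]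
  and_intros
  all_goals try omega
  -- Arrays `2` to `5` are tracked as blank because each later round takes fresh zero tables instead
  -- of clearing old ones.
  refine .seq (WP.loop hN (fun k s => Std n m μ B len s ∧ s.reg 5 = k ∧
    (∀ i < k, arr s.mem 6 i = inputKey env.inbox i) ∧
    arr s.mem 1 = hist k (fun i => inputKey env.inbox i / B) (fun _ => 1) ∧
    arr s.mem 2 = (fun _ => 0) ∧ arr s.mem 3 = (fun _ => 0) ∧ arr s.mem 4 = (fun _ => 0) ∧
    arr s.mem 5 = (fun _ => 0) ∧ s.outbox = [] ∧ s.output = [] ∧ s.peak ≤ 8 * U + 8 ∧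
    s.time ≤ 50 + 50 * k) len (by omega) ?_ ?_ ?_ ?_)
  · refine ⟨⟨by simp, by simp, by simp, by simp [hBdef, blockLength], by simp [hlendef]⟩, by simp, ?_⟩
    simp [hist_zero]
    refine ⟨rfl, rfl, rfl, rfl, rfl⟩
  · rintro k t ⟨hs, h5, -⟩
    exact ⟨h5, by simp only [Expr.Fits, hs.r4]; omega, hs.r4⟩
  · rintro k hk t ⟨hs, h5, h6, ha1, ha2, ha3, ha4, ha5, ho, hp, hpk, hT⟩
    refine .block hN ?_
    have hk1 := hkey k
    have hk2 := hdiv k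
    have hk3 := hin k
    have hk4 := hin (k / 2 * 2 + 1)
    have hB3 := hs.r3
    -- Array `1` is read after the store to array `6`. This is the reduced form in which `8 * x + 1`
    -- and `8 * k + 6` are compared.
    have e1 : ∀ x, ¬ 8 * x = 8 * k + 5 := by omega
    have e2 : ∀ x, t.mem (8 * x + 1) = hist k (fun i => inputKey env.inbox i / B) (fun _ => 1) x :=
      congrFun ha1
    have e3 := hist_le (k := k) (a := fun i => inputKey env.inbox i / B) (v := fun _ => 1)
      (fun _ => le_rfl) (inputKey env.inbox k / B)
    simp only [BlockWP, Instr.Fits, Instr.exact, Expr.Fits, Expr.val, BinOp.Fits, BinOp.apply,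
      Expr.cost, State.tick, h5, Function.update_apply, Nat.reduceEqDiff, reduceIte, hB3, e1, e2,
      ← inputKey.eq_1, and_true, true_and]
    and_intros
    all_goals try omega
    · constructor <;> simp [hs.r0, hs.r1, hs.r2, hs.r3, hs.r4]
    · rw [arr_update_ne _ (by norm_num) (by norm_num) (by norm_num), arr_update_same]
      intro i hi
      rw [Function.update_apply]
      split_ifs with h
      · rw [h]
      · exact h6 i (by omega)
    · rw [arr_update_same, arr_update_ne _ (by norm_num) (by norm_num) (by norm_num), ha1]
      exact update_hist k (fun i => inputKey env.inbox i / B) (fun _ => 1)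
    all_goals first | assumption | simpa [arr_update_ne]
  rintro t ⟨hs, h5, h6, ha1, ha2, ha3, ha4, ha5, ho, hp, hpk, hT⟩
  refine WP.loop hN (fun k s => Std n m μ B len s ∧ s.reg 5 = k ∧
    s.mem = t.mem ∧ s.outbox = (List.range k).map (fun b => (b,
      hist len (fun i => inputKey env.inbox i / B) (fun _ => 1) b)) ∧
    s.output = [] ∧ s.peak ≤ 8 * U + 8 ∧ s.time ≤ t.time + 20 + 20 * k) m (by omega) ?_ ?_ ?_ ?_
  · simp only [State.tick, Expr.cost, ho, hp]
    and_intros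
    all_goals try omega
    · constructor <;> simp [hs.r0, hs.r1, hs.r2, hs.r3, hs.r4]
    all_goals simp
  · rintro k s ⟨hs, h5, -⟩
    exact ⟨h5, by simp only [Expr.Fits, hs.r1]; omega, hs.r1⟩
  · rintro k hk s ⟨hs, h5, hmem, ho, hp, hpk, hT⟩
    refine .block hN ?_
    have e2 : ∀ x, t.mem (8 * x + 1) = hist len (fun i => inputKey env.inbox i / B) (fun _ => 1) x :=
      congrFun ha1
    have e3 := hist_le (k := len) (a := fun i => inputKey env.inbox i / B) (v := fun _ => 1)
      (fun _ => le_rfl) k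
    simp only [BlockWP, Instr.Fits, Instr.exact, Expr.Fits, Expr.val, BinOp.Fits, BinOp.apply,
      Expr.cost, State.tick, h5, Function.update_apply, Nat.reduceEqDiff, reduceIte, e2, hmem,
      and_true, true_and]
    and_intros
    all_goals try omega
    · constructor <;> simp [hs.r0, hs.r1, hs.r2, hs.r3, hs.r4]
    · simp [ho, List.range_succ]
  · rintro s ⟨hs, h5, hmem, ho, hp, hpk, hT⟩
    rw [← hmem] at ha2 ha3 ha4 ha5 h6
    refine ⟨⟨⟨hs.1, hs.2, hs.3, hs.4, hs.5⟩, h6, ha2, ha3, ha4, ha5, hp, hpk⟩, ho, ?_⟩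
    simp only [State.tick, Expr.cost] at *
    omega

/-! ### Round two: block totals. -/

/-- Add up the counts received and broadcast the total. -/
def totalProg : Prog :=
  .seq (block [.assign 6 (.const 0)]) <|
  .seq (loop 5 (.reg 1) (block [.assign 6 (.bin .add (.reg 6) (.inGet (.reg 5)))])) <|
  loop 5 (.reg 1) (block [.send (.reg 5) (.reg 6)])

theorem totalProg_spec {env : Env} {n m U μ B len P : ℕ} {key : ℕ → ℕ} {s : State}
    (hs : Stored n m μ B len key P s) (hm : m ≤ U) (hU : 8 * U + 8 < env.size)
    (hin : ∀ i, env.inbox.getD i 0 < env.size)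
    (hsum : ∑ i ∈ range m, env.inbox.getD i 0 < env.size) :
    WP env totalProg (fun s => Stored n m μ B len key P s ∧
      s.outbox = (List.range m).map (fun b => (b, ∑ i ∈ range m, env.inbox.getD i 0)) ∧
      s.time ≤ 100 * U + 100) s.startRound := by
  have hN : 1 < env.size := by omega
  obtain ⟨hs, hk, ha2, ha3, ha4, ha5, hp, hpk⟩ := hs
  refine .seq (.block hN ?_)
  simp only [BlockWP, Instr.Fits, Instr.exact, Expr.Fits, Expr.val, State.startRound, Expr.cost]
  refine ⟨by omega, ?_⟩
  refine .seq (WP.loop hN (fun k t => Std n m μ B len t ∧ t.reg 5 = k ∧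
    t.reg 6 = ∑ i ∈ range k, env.inbox.getD i 0 ∧ t.mem = s.mem ∧ t.outbox = [] ∧
    t.output = [] ∧ t.peak ≤ P ∧ t.time ≤ 20 + 20 * k) m (by omega) ?_ ?_ ?_ ?_)
  · and_intros
    · constructor <;> simp [hs.r0, hs.r1, hs.r2, hs.r3, hs.r4]
    all_goals simp [hp, hpk]
  · rintro k t ⟨hs, h5, -⟩
    exact ⟨h5, by simp only [Expr.Fits, hs.r1]; omega, hs.r1⟩
  · rintro k hk t ⟨hs, h5, h6, hmem, ho, hp, hpk, hT⟩
    refine .block hN ?_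
    have e1 := hin k
    have e2 : ∑ i ∈ range (k + 1), env.inbox.getD i 0 ≤ ∑ i ∈ range m, env.inbox.getD i 0 :=
      sum_le_sum_of_subset (range_mono hk)
    rw [sum_range_succ] at e2
    simp only [BlockWP, Instr.Fits, Instr.exact, Expr.Fits, Expr.val, BinOp.Fits, BinOp.apply,
      Expr.cost, State.tick, h5, h6, Function.update_apply, Nat.reduceEqDiff, reduceIte,
      and_true, true_and]
    and_intros
    all_goals try omega
    · constructor <;> simp [hs.r0, hs.r1, hs.r2, hs.r3, hs.r4]
    · rw [sum_range_succ]
  rintro t ⟨hs, -, h6, hmem, ho, hp, hpk, hT⟩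
  refine WP.loop hN (fun k t => Std n m μ B len t ∧ t.reg 5 = k ∧
    t.reg 6 = ∑ i ∈ range m, env.inbox.getD i 0 ∧ t.mem = s.mem ∧
    t.outbox = (List.range k).map (fun b => (b, ∑ i ∈ range m, env.inbox.getD i 0)) ∧
    t.output = [] ∧ t.peak ≤ P ∧ t.time ≤ 50 + 20 * m + 20 * k) m (by omega) ?_ ?_ ?_ ?_
  · simp only [State.tick, Expr.cost]
    and_intros
    all_goals try omega
    · constructor <;> simp [hs.r0, hs.r1, hs.r2, hs.r3, hs.r4]
    all_goals simp [*]
  · rintro k t ⟨hs, h5, -⟩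
    exact ⟨h5, by simp only [Expr.Fits, hs.r1]; omega, hs.r1⟩
  · rintro k hk t ⟨hs, h5, h6, hmem, ho, hp, hpk, hT⟩
    refine .block hN ?_
    simp only [BlockWP, Instr.Fits, Instr.exact, Expr.Fits, Expr.val, BinOp.Fits, BinOp.apply,
      Expr.cost, State.tick, h5, h6, Function.update_apply, Nat.reduceEqDiff, reduceIte,
      and_true, true_and]
    and_intros
    all_goals try omega
    · constructor <;> simp [hs.r0, hs.r1, hs.r2, hs.r3, hs.r4]
    · simp [ho, List.range_succ]
  · rintro t ⟨hs, h5, h6, hmem, ho, hp, hpk, hT⟩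
    rw [← hmem] at ha2 ha3 ha4 ha5 hk
    refine ⟨⟨⟨hs.1, hs.2, hs.3, hs.4, hs.5⟩, hk, ha2, ha3, ha4, ha5, hp, hpk⟩, ho, ?_⟩
    simp only [State.tick, Expr.cost] at *
    omega

/-! ### Round three: routing the keys to the machines of their block. -/

/-- With `W b` keys in block `b`, the number of the first machine of block `b`; the block has
`W b / B + 1` machines. -/
def firstMachine (B : ℕ) (W : ℕ → ℕ) (b : ℕ) : ℕ := ∑ i ∈ range b, (W i / B + 1)

/-- The machine to which the `j`-th key is sent: the keys of a block go to the machines of the block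
in turn. -/
def route (B : ℕ) (W key : ℕ → ℕ) (j : ℕ) : ℕ :=
  firstMachine B W (key j / B) +
    hist j (fun i => key i / B) (fun _ => 1) (key j / B) % (W (key j / B) / B + 1)

theorem firstMachine_mono (B : ℕ) (W : ℕ → ℕ) : Monotone (firstMachine B W) :=
  fun _ _ h => sum_le_sum_of_subset (range_mono h)

theorem route_lt (B : ℕ) (W key : ℕ → ℕ) (j : ℕ) :
    route B W key j < firstMachine B W (key j / B + 1) := by
  rw [firstMachine, sum_range_succ]
  exact Nat.add_lt_add_left (Nat.mod_lt _ (Nat.succ_pos _)) _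

/-- Assign machines to the blocks in proportion to their totals, and send the keys of each block to the
machines of the block in turn. -/
def routeProg : Prog :=
  .seq (block [.assign 6 (.const 0)]) <|
  .seq (loop 5 (.reg 1) (block [
    .store (.bin .add (.bin .mul (.const 8) (.reg 5)) (.const 2)) (.reg 6),
    .assign 6 (.bin .add (.reg 6)
      (.bin .add (.bin .div (.inGet (.reg 5)) (.reg 3)) (.const 1)))])) <|
  loop 5 (.reg 4) (block [
    .load 6 (.bin .add (.bin .mul (.const 8) (.reg 5)) (.const 6)),
    .assign 7 (.bin .div (.reg 6) (.reg 3)),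
    .load 8 (.bin .add (.bin .mul (.const 8) (.reg 7)) (.const 2)),
    .load 9 (.bin .add (.bin .mul (.const 8) (.reg 7)) (.const 3)),
    .send (.bin .add (.reg 8) (.bin .mod (.reg 9)
      (.bin .add (.bin .div (.inGet (.reg 7)) (.reg 3)) (.const 1)))) (.reg 6),
    .store (.bin .add (.bin .mul (.const 8) (.reg 7)) (.const 3)) (.bin .add (.reg 9) (.const 1))])

theorem routeProg_spec {env : Env} {n m U μ B len : ℕ} {key : ℕ → ℕ} {s : State}
    (hs : Stored n m μ B len key (8 * U + 8) s) (hm : m ≤ U) (hlen : len ≤ U) (hB : B ≤ U)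
    (hU : 8 * U + 8 < env.size) (hn : n < env.size)
    (hkey : ∀ i, key i ≤ n) (hnB : n < m * B)
    (hin : ∀ i, env.inbox.getD i 0 < env.size)
    (hsum : firstMachine B (env.inbox.getD · 0) m < env.size) :
    WP env routeProg (fun s => Std n m μ B len s ∧ arr s.mem 4 = (fun _ => 0) ∧
      arr s.mem 5 = (fun _ => 0) ∧
      s.outbox = (List.range len).map (fun j => (route B (env.inbox.getD · 0) key j, key j)) ∧
      s.output = [] ∧ s.peak ≤ 8 * U + 8 ∧ s.time ≤ 100 * U + 100) s.startRound := by
  have hN : 1 < env.size := by omega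
  have hdiv : ∀ i, key i / B < m := fun i =>
    Nat.div_lt_of_lt_mul (by have := hkey i; rw [mul_comm] at hnB; omega)
  obtain ⟨hs, hk, ha2, ha3, ha4, ha5, hp, hpk⟩ := hs
  set W : ℕ → ℕ := (env.inbox.getD · 0) with hW
  have hWi : ∀ i, env.inbox.getD i 0 = W i := fun _ => rfl
  simp only [hWi] at hin
  clear_value W
  have hfirst : ∀ b < m, firstMachine B W b + (W b / B + 1) < env.size := by
    intro b hb
    have := firstMachine_mono B W (show b + 1 ≤ m from hb)
    rw [firstMachine, sum_range_succ, ← firstMachine] at this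
    omega
  refine .seq (.block hN ?_)
  simp only [BlockWP, Instr.Fits, Instr.exact, Expr.Fits, Expr.val, State.startRound, Expr.cost]
  refine ⟨by omega, ?_⟩
  refine .seq (WP.loop hN (fun k t => Std n m μ B len t ∧ t.reg 5 = k ∧
    t.reg 6 = firstMachine B W k ∧
    (∀ i < len, arr t.mem 6 i = key i) ∧ (∀ i < k, arr t.mem 2 i = firstMachine B W i) ∧
    arr t.mem 3 = (fun _ => 0) ∧ arr t.mem 4 = (fun _ => 0) ∧ arr t.mem 5 = (fun _ => 0) ∧
    t.outbox = [] ∧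
    t.output = [] ∧ t.peak ≤ 8 * U + 8 ∧ t.time ≤ 20 + 30 * k) m (by omega) ?_ ?_ ?_ ?_)
  · and_intros
    · constructor <;> simp [hs.r0, hs.r1, hs.r2, hs.r3, hs.r4]
    all_goals try simp [*]
    · simp [firstMachine]
    · exact hk
  · rintro k t ⟨hs, h5, -⟩
    exact ⟨h5, by simp only [Expr.Fits, hs.r1]; omega, hs.r1⟩
  · rintro k hkm t ⟨hs, h5, h6, hk, ha2, ha3, ha4, ha5, ho, hp, hpk, hT⟩
    refine .block hN ?_
    have hB3 := hs.r3
    have e1 := hin k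
    have e2 := hfirst k hkm
    simp only [BlockWP, Instr.Fits, Instr.exact, Expr.Fits, Expr.val, BinOp.Fits, BinOp.apply,
      Expr.cost, State.tick, h5, h6, hB3, hWi, Function.update_apply, Nat.reduceEqDiff, reduceIte,
      and_true, true_and]
    have e3 : firstMachine B W (k + 1) = firstMachine B W k + (W k / B + 1) := by
      rw [firstMachine, sum_range_succ, ← firstMachine]
    have e4 := Nat.div_le_self (W k) B
    have e5 : firstMachine B W k < env.size := lt_of_le_of_lt (Nat.le_add_right _ _) e2
    and_intros
    all_goals try first | exact e5 | omega
    · constructor <;> simp [hs.r0, hs.r1, hs.r2, hs.r3, hs.r4]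
    · simpa [arr_update_ne] using hk
    · intro i hi
      rw [arr_update_same]
      rw [Function.update_apply]
      split_ifs with h
      · rw [h]
      · exact ha2 i (by omega)
    all_goals first | assumption | simpa [arr_update_ne]
  rintro t ⟨hs, -, h6, hk, ha2, ha3, ha4, ha5, ho, hp, hpk, hT⟩
  refine WP.loop hN (fun k t => Std n m μ B len t ∧ t.reg 5 = k ∧
    (∀ i < len, arr t.mem 6 i = key i) ∧ (∀ i < m, arr t.mem 2 i = firstMachine B W i) ∧
    arr t.mem 3 = hist k (fun i => key i / B) (fun _ => 1) ∧
    arr t.mem 4 = (fun _ => 0) ∧ arr t.mem 5 = (fun _ => 0) ∧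
    t.outbox = (List.range k).map (fun j => (route B W key j, key j)) ∧
    t.output = [] ∧ t.peak ≤ 8 * U + 8 ∧ t.time ≤ 50 + 30 * m + 60 * k) len (by omega) ?_ ?_ ?_ ?_
  · simp only [State.tick, Expr.cost]
    and_intros
    all_goals try omega
    · constructor <;> simp [hs.r0, hs.r1, hs.r2, hs.r3, hs.r4]
    all_goals try simp [*]
    · rfl
  · rintro k t ⟨hs, h5, -⟩
    exact ⟨h5, by simp only [Expr.Fits, hs.r4]; omega, hs.r4⟩
  · rintro k hkm t ⟨hs, h5, hk, ha2, ha3, ha4, ha5, ho, hp, hpk, hT⟩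
    refine .block hN ?_
    have hB3 := hs.r3
    have hd := hdiv k
    have e1 := hin (key k / B)
    have e2 := hfirst (key k / B) (hdiv k)
    have e3 := hkey k
    have e4 : t.mem (8 * k + 6) = key k := hk k hkm
    have e5 : t.mem (8 * (key k / B) + 2) = firstMachine B W (key k / B) := ha2 _ (hdiv k)
    have e6 : t.mem (8 * (key k / B) + 3) = hist k (fun i => key i / B) (fun _ => 1) (key k / B) :=
      congrFun ha3 _
    have e7 := hist_le (k := k) (a := fun i => key i / B) (v := fun _ => 1)
      (fun _ => le_rfl) (key k / B)
    have e8 := Nat.mod_lt (hist k (fun i => key i / B) (fun _ => 1) (key k / B))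
      (Nat.succ_pos (W (key k / B) / B))
    simp only [BlockWP, Instr.Fits, Instr.exact, Expr.Fits, Expr.val, BinOp.Fits, BinOp.apply,
      Expr.cost, State.tick, h5, hB3, hWi, Function.update_apply, Nat.reduceEqDiff, reduceIte,
      e4, e5, e6, and_true, true_and]
    have e9 := Nat.div_le_self (W (key k / B)) B
    rw [Nat.succ_eq_add_one] at e8
    generalize hr : hist k (fun i => key i / B) (fun _ => 1) (key k / B) %
      (W (key k / B) / B + 1) = r at *
    and_intros
    all_goals try omega
    · constructor <;> simp [hs.r0, hs.r1, hs.r2, hs.r3, hs.r4]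
    · simpa [arr_update_ne] using hk
    · simpa [arr_update_ne] using ha2
    · rw [arr_update_same, ha3]
      exact update_hist k (fun i => key i / B) (fun _ => 1)
    · simpa [arr_update_ne]
    · simpa [arr_update_ne]
    · simp [ho, List.range_succ, route, hr]
  · rintro t ⟨hs, h5, -, -, -, ha4, ha5, ho, hp, hpk, hT⟩
    refine ⟨⟨hs.1, hs.2, hs.3, hs.4, hs.5⟩, ha4, ha5, ho, hp, hpk, ?_⟩
    simp only [State.tick, Expr.cost] at *
    omega

/-! ### Round four: counting within a block. -/

/-- The word that carries the number of occurrences of the key with offset `o` in an inbox whose keys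
all lie in one block. -/
def countWord (m B : ℕ) (l : List ℕ) (o : ℕ) : ℕ :=
  hist l.length (fun i => l.getD i 0 % B) (fun _ => 1) o * (m * B) + (l.getD 0 0 / B * B + o)

/-- Count the keys received by offset, and send each count to the machine of its residue modulo `m`. -/
def gatherProg : Prog :=
  .seq (block [.assign 7 (.bin .div (.inGet (.const 0)) (.reg 3))]) <|
  .seq (loop 5 .inLen (block [
    .assign 6 (.bin .add (.bin .mul (.const 8) (.bin .mod (.inGet (.reg 5)) (.reg 3))) (.const 4)),
    .load 8 (.reg 6),
    .store (.reg 6) (.bin .add (.reg 8) (.const 1))])) <|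
  loop 5 (.reg 3) (block [
    .load 6 (.bin .add (.bin .mul (.const 8) (.reg 5)) (.const 4)),
    .send (.bin .mod (.reg 5) (.reg 1)) (.bin .add (.bin .mul (.reg 6) (.bin .mul (.reg 1) (.reg 3)))
      (.bin .add (.bin .mul (.reg 7) (.reg 3)) (.reg 5)))])

theorem gatherProg_spec {env : Env} {n m U μ B len : ℕ} {s : State}
    (hs : Std n m μ B len s) (ha4 : arr s.mem 4 = fun _ => 0) (ha5 : arr s.mem 5 = fun _ => 0)
    (hp : s.output = []) (hpk : s.peak ≤ 8 * U + 8)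
    (hlen : env.inbox.length ≤ U) (hm : m ≤ U) (hB : B ≤ U) (hBpos : 0 < B)
    (hU : 8 * U + 8 < env.size) (hin : ∀ i, env.inbox.getD i 0 ≤ n)
    (hbig : U * (m * B) + n + B < env.size) :
    WP env gatherProg (fun s => Std n m μ B len s ∧ arr s.mem 5 = (fun _ => 0) ∧
      s.outbox = (List.range B).map (fun o => (o % m, countWord m B env.inbox o)) ∧
      s.output = [] ∧ s.peak ≤ 8 * U + 8 ∧ s.time ≤ 100 * U + 100) s.startRound := by
  have hN : 1 < env.size := by omega
  -- With an empty inbox the default `0` selects block `0`, harmlessly: all counts sent are then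
  -- zero.
  set b := env.inbox.getD 0 0 / B with hb
  have hi0 := hin 0
  have hbn : b ≤ n := (Nat.div_le_self _ _).trans hi0
  have hbB : b * B ≤ n := (Nat.div_mul_le_self _ _).trans hi0
  have hB3 := hs.r3
  have hcnt : ∀ k ≤ env.inbox.length, ∀ o, hist k (fun i => env.inbox.getD i 0 % B) (fun _ => 1) o ≤ U :=
    fun k hk o => (hist_le (fun _ => le_rfl) o).trans (hk.trans hlen)
  refine .seq (.block hN ?_)
  simp only [BlockWP, Instr.Fits, Instr.exact, Expr.Fits, Expr.val, BinOp.Fits, BinOp.apply,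
    State.startRound, Expr.cost, hB3, and_true, ← hb]
  refine ⟨⟨⟨by omega, by omega⟩, by omega⟩, ?_⟩
  refine .seq (WP.loop hN (fun k t => Std n m μ B len t ∧ t.reg 5 = k ∧ t.reg 7 = b ∧
    arr t.mem 4 = hist k (fun i => env.inbox.getD i 0 % B) (fun _ => 1) ∧
    arr t.mem 5 = (fun _ => 0) ∧ t.outbox = [] ∧
    t.output = [] ∧ t.peak ≤ 8 * U + 8 ∧ t.time ≤ 20 + 40 * k) env.inbox.length (by omega) ?_ ?_ ?_ ?_)
  · and_intros
    · constructor <;> simp [hs.r0, hs.r1, hs.r2, hs.r3, hs.r4]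
    all_goals simp [*]
    rfl
  · rintro k t ⟨hs, h5, -⟩
    exact ⟨h5, by simp only [Expr.Fits]; omega, rfl⟩
  · rintro k hk t ⟨hs, h5, h7, ha4, ha5, ho, hp, hpk, hT⟩
    refine .block hN ?_
    have hB3 := hs.r3
    have e1 := hin k
    have e2 := Nat.mod_lt (env.inbox.getD k 0) hBpos
    have e3 : ∀ x, t.mem (8 * x + 4) = hist k (fun i => env.inbox.getD i 0 % B) (fun _ => 1) x :=
      congrFun ha4
    have e4 := hcnt k hk.le (env.inbox.getD k 0 % B)
    simp only [BlockWP, Instr.Fits, Instr.exact, Expr.Fits, Expr.val, BinOp.Fits, BinOp.apply,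
      Expr.cost, State.tick, h5, h7, hB3, e3, Function.update_apply, Nat.reduceEqDiff, reduceIte,
      and_true, true_and]
    and_intros
    all_goals try omega
    · constructor <;> simp [hs.r0, hs.r1, hs.r2, hs.r3, hs.r4]
    · rw [arr_update_same, ha4]
      exact update_hist k (fun i => env.inbox.getD i 0 % B) (fun _ => 1)
    · simpa [arr_update_ne]
  rintro t ⟨hs, -, h7, ha4, ha5, ho, hp, hpk, hT⟩
  refine WP.loop hN (fun k t => Std n m μ B len t ∧ t.reg 5 = k ∧ t.reg 7 = b ∧
    arr t.mem 4 = hist env.inbox.length (fun i => env.inbox.getD i 0 % B) (fun _ => 1) ∧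
    arr t.mem 5 = (fun _ => 0) ∧
    t.outbox = (List.range k).map (fun o => (o % m, countWord m B env.inbox o)) ∧
    t.output = [] ∧ t.peak ≤ 8 * U + 8 ∧ t.time ≤ 50 + 40 * env.inbox.length + 40 * k)
    B (by omega) ?_ ?_ ?_ ?_
  · simp only [State.tick, Expr.cost]
    and_intros
    all_goals try omega
    · constructor <;> simp [hs.r0, hs.r1, hs.r2, hs.r3, hs.r4]
    all_goals simp [*]
  · rintro k t ⟨hs, h5, -⟩
    exact ⟨h5, by simp only [Expr.Fits, hs.r3]; omega, hs.r3⟩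
  · rintro k hk t ⟨hs, h5, h7, ha4, ha5, ho, hp, hpk, hT⟩
    refine .block hN ?_
    have hB3 := hs.r3
    have hr1 := hs.r1
    have e3 : ∀ x, t.mem (8 * x + 4) =
        hist env.inbox.length (fun i => env.inbox.getD i 0 % B) (fun _ => 1) x := congrFun ha4
    have e4 := hcnt _ le_rfl k
    have e5 := Nat.mul_le_mul_right (m * B) e4
    have e6 : m * B < env.size := by
      have := Nat.mul_le_mul_right (m * B) (hBpos.trans_le hB)
      omega
    simp only [BlockWP, Instr.Fits, Instr.exact, Expr.Fits, Expr.val, BinOp.Fits, BinOp.apply,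
      Expr.cost, State.tick, h5, h7, hB3, hr1, e3, Function.update_apply, Nat.reduceEqDiff, reduceIte,
      and_true, true_and]
    and_intros
    all_goals try omega
    · constructor <;> simp [hs.r0, hs.r1, hs.r2, hs.r3, hs.r4]
    · simp [ho, List.range_succ, countWord, hb]
  · rintro t ⟨hs, h5, -, -, ha5, ho, hp, hpk, hT⟩
    refine ⟨⟨hs.1, hs.2, hs.3, hs.4, hs.5⟩, ha5, ho, hp, hpk, ?_⟩
    simp only [State.tick, Expr.cost] at *
    omega

/-! ### Round five: totals and output. -/

/-- The sum of the counts received for entry `a` of the final array. -/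
def total (m B : ℕ) (l : List ℕ) (a : ℕ) : ℕ :=
  hist l.length (fun i => l.getD i 0 % (m * B) / m) (fun i => l.getD i 0 / (m * B)) a

/-- Add up the counts received for each vertex and output them. -/
def outputProg : Prog :=
  .seq (loop 5 .inLen (block [
    .assign 6 (.bin .add (.bin .mul (.const 8) (.bin .div (.bin .mod (.inGet (.reg 5))
      (.bin .mul (.reg 1) (.reg 3))) (.reg 1))) (.const 5)),
    .load 8 (.reg 6),
    .store (.reg 6) (.bin .add (.reg 8) (.bin .div (.inGet (.reg 5))
      (.bin .mul (.reg 1) (.reg 3))))])) <|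
  loop 5 (.bin .add (.bin .div (.reg 0) (.reg 1)) (.const 1)) (.seq (block [
    .assign 6 (.bin .add (.bin .mul (.reg 5) (.reg 1)) (.reg 2)),
    .load 7 (.bin .add (.bin .mul (.const 8) (.reg 5)) (.const 5))])
    (.ite (.bin .mul (.bin .lt (.const 0) (.reg 6))
        (.bin .lt (.reg 6) (.bin .add (.reg 0) (.const 1))))
      (block [.emit (.reg 6), .emit (.reg 7)]) (block [])))

theorem hist_mono {a v : ℕ → ℕ} {k k' : ℕ} (h : k ≤ k') (b : ℕ) : hist k a v b ≤ hist k' a v b :=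
  sum_le_sum_of_subset (range_mono h)

theorem outputProg_spec {env : Env} {n m U μ B len : ℕ} {s : State}
    (hs : Std n m μ B len s) (ha5 : arr s.mem 5 = fun _ => 0)
    (hp : s.output = []) (hpk : s.peak ≤ 8 * U + 8) (hμ : μ < m)
    (hlen : env.inbox.length ≤ U) (hm : m ≤ U) (hB : B ≤ U) (hBpos : 0 < B) (hnm : n / m + 1 ≤ U)
    (hU : 8 * U + 8 < env.size) (hin : ∀ i, env.inbox.getD i 0 < env.size)
    (hmB : m * B < env.size) (hn : 2 * n + 1 < env.size)
    (htot : ∀ a, total m B env.inbox a < env.size) :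
    WP env outputProg (fun s =>
      s.output = (List.range (n / m + 1)).flatMap (fun a =>
        if 0 < a * m + μ ∧ a * m + μ ≤ n then [a * m + μ, total m B env.inbox a] else []) ∧
      s.outbox = [] ∧ s.peak ≤ 8 * U + 8 ∧ s.time ≤ 100 * U + 100) s.startRound := by
  have hN : 1 < env.size := by omega
  have hmpos : 0 < m := by omega
  refine .seq (WP.loop hN (fun k t => Std n m μ B len t ∧ t.reg 5 = k ∧
    arr t.mem 5 = hist k (fun i => env.inbox.getD i 0 % (m * B) / m)
      (fun i => env.inbox.getD i 0 / (m * B)) ∧ t.outbox = [] ∧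
    t.output = [] ∧ t.peak ≤ 8 * U + 8 ∧ t.time ≤ 20 + 40 * k) env.inbox.length (by omega) ?_ ?_ ?_ ?_)
  · simp only [State.startRound]
    and_intros
    · constructor <;> simp [hs.r0, hs.r1, hs.r2, hs.r3, hs.r4]
    all_goals simp [*]
    rfl
  · rintro k t ⟨hs, h5, -⟩
    exact ⟨h5, by simp only [Expr.Fits]; omega, rfl⟩
  · rintro k hk t ⟨hs, h5, ha5, ho, hp, hpk, hT⟩
    refine .block hN ?_
    have hB3 := hs.r3
    have hr1 := hs.r1
    have e1 := hin k
    have e2 : env.inbox.getD k 0 % (m * B) / m < B :=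
      Nat.div_lt_of_lt_mul (Nat.mod_lt _ (Nat.mul_pos hmpos hBpos))
    have e3 : ∀ x, t.mem (8 * x + 5) = hist k (fun i => env.inbox.getD i 0 % (m * B) / m)
      (fun i => env.inbox.getD i 0 / (m * B)) x := congrFun ha5
    have e4 := update_hist k (fun i => env.inbox.getD i 0 % (m * B) / m)
      (fun i => env.inbox.getD i 0 / (m * B))
    have e5 := (hist_mono hk _).trans_lt (htot (env.inbox.getD k 0 % (m * B) / m))
    rw [← e4, Function.update_self] at e5
    simp only [BlockWP, Instr.Fits, Instr.exact, Expr.Fits, Expr.val, BinOp.Fits, BinOp.apply,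
      Expr.cost, State.tick, h5, hB3, hr1, e3, Function.update_apply, Nat.reduceEqDiff, reduceIte,
      and_true, true_and]
    have e6 := lt_of_le_of_lt (Nat.le_add_right _ _) e5
    and_intros
    all_goals try first | exact e5 | exact e6 | omega
    · constructor <;> simp [hs.r0, hs.r1, hs.r2, hs.r3, hs.r4]
    · rw [arr_update_same, ha5]
      exact e4
  rintro t ⟨hs, -, ha5, ho, hp, hpk, hT⟩
  have hdm := Nat.div_mul_le_self n m
  have hdn := Nat.div_le_self n m
  refine WP.loop hN (fun k t => Std n m μ B len t ∧ t.reg 5 = k ∧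
    arr t.mem 5 = total m B env.inbox ∧
    t.output = (List.range k).flatMap (fun a =>
        if 0 < a * m + μ ∧ a * m + μ ≤ n then [a * m + μ, total m B env.inbox a] else []) ∧
    t.outbox = [] ∧ t.peak ≤ 8 * U + 8 ∧ t.time ≤ 50 + 40 * env.inbox.length + 50 * k)
    (n / m + 1) (by omega) ?_ ?_ ?_ ?_
  · simp only [State.tick, Expr.cost]
    and_intros
    all_goals try omega
    · constructor <;> simp [hs.r0, hs.r1, hs.r2, hs.r3, hs.r4]
    all_goals simp [*]
    rfl
  · rintro k t ⟨hs, h5, -⟩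
    refine ⟨h5, ?_, by simp only [Expr.val, BinOp.apply, hs.r0, hs.r1]⟩
    simp only [Expr.Fits, Expr.val, BinOp.Fits, BinOp.apply, hs.r0, hs.r1, and_true, true_and]
    and_intros <;> omega
  · rintro k hk t ⟨hs, h5, ha5, hout, ho, hpk, hT⟩
    have hr0 := hs.r0
    have hr1 := hs.r1
    have hr2 := hs.r2
    have e3 : ∀ x, t.mem (8 * x + 5) = total m B env.inbox x := congrFun ha5
    have e4 := htot k
    have e5 : k * m ≤ n := (Nat.mul_le_mul_right m (Nat.le_of_lt_succ hk)).trans hdm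
    have e6 : m < env.size := by omega
    -- On the last pass `k * m + μ` may exceed `n`. It stays below `2 * n` if `m ≤ n`, and it is
    -- just `μ` if `n < m`.
    have e7 : k * m + μ < env.size := by
      rcases Nat.lt_or_ge n m with h | h
      · have : k = 0 := by rw [Nat.div_eq_of_lt h] at hk; omega
        subst this; omega
      · omega
    refine .seq (.block hN ?_)
    simp only [BlockWP, Instr.Fits, Instr.exact, Expr.Fits, Expr.val, BinOp.Fits, BinOp.apply,
      Expr.cost, State.tick, h5, hr1, hr2, e3, Function.update_apply, Nat.reduceEqDiff, reduceIte,
      and_true, true_and]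
    and_intros
    all_goals try omega
    -- The product of two comparisons serves as their conjunction. It discards the dummy key `0` and
    -- the keys beyond `n`.
    have e8 : (if 0 < k * m + μ then 1 else 0) * (if k * m + μ < n + 1 then 1 else 0) ≤ 1 := by
      split_ifs <;> omega
    refine .ite hN ?_ ?_ ?_
    · simp only [Expr.Fits, Expr.val, BinOp.Fits, BinOp.apply, Function.update_apply,
        Nat.reduceEqDiff, reduceIte, hr0, and_true, true_and]
      and_intros
      all_goals omega
    · simp only [Expr.val, BinOp.apply, Function.update_apply, Nat.reduceEqDiff, reduceIte, hr0]
      intro hc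
      have hc' : 0 < k * m + μ ∧ k * m + μ ≤ n := by
        split_ifs at hc <;> omega
      refine .block hN ?_
      simp only [BlockWP, Instr.Fits, Instr.exact, Expr.Fits, Expr.val, BinOp.Fits, BinOp.apply,
        Expr.cost, State.tick, h5, Function.update_apply, Nat.reduceEqDiff, reduceIte,
        true_and]
      and_intros
      all_goals try omega
      · constructor <;> simp [hs.r0, hs.r1, hs.r2, hs.r3, hs.r4]
      · rw [hout, List.range_succ, List.flatMap_append, List.flatMap_singleton, if_pos hc',
          List.append_assoc]
        rfl
    · simp only [Expr.val, BinOp.apply, Function.update_apply, Nat.reduceEqDiff, reduceIte, hr0]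
      intro hc
      have hc' : ¬ (0 < k * m + μ ∧ k * m + μ ≤ n) := by
        rintro ⟨h1, h2⟩
        rw [if_pos h1, if_pos (by omega)] at hc
        omega
      refine .block hN ?_
      simp only [BlockWP, Expr.cost, State.tick, h5, Function.update_apply, Nat.reduceEqDiff,
        reduceIte, true_and]
      and_intros
      all_goals try omega
      · constructor <;> simp [hs.r0, hs.r1, hs.r2, hs.r3, hs.r4]
      · rw [hout, List.range_succ, List.flatMap_append, List.flatMap_singleton, if_neg hc',
          List.append_nil]
  · rintro t ⟨hs, h5, ha5, hout, ho, hpk, hT⟩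
    refine ⟨hout, ho, hpk, ?_⟩
    simp only [State.tick, Expr.cost] at *
    omega

/-! ### Delivery of messages. -/

/-- Inboxes are ordered by sender, so if everyone sends one word to everyone, positions in the inbox
are sender numbers. The programs rely on this when they index the inbox by a machine or block. -/
theorem delivered_broadcast {m : ℕ} {c : Fin m → State} {f : Fin m → ℕ → ℕ}
    (h : ∀ ν, (c ν).outbox = (List.range m).map fun b => (b, f ν b)) (μ : Fin m) :
    delivered c μ = (List.finRange m).map fun ν => f ν μ := by
  have key : ∀ ν, ((c ν).outbox.filter (fun x => x.1 = μ.val)).map Prod.snd = [f ν μ] := by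
    intro ν
    rw [h ν, List.filter_map, List.map_map]
    have : (List.range m).filter ((fun x : ℕ × ℕ => decide (x.1 = μ.val)) ∘ fun b => (b, f ν b)) =
        [μ.val] := by
      have h1 := List.filter_eq (l := List.range m) μ.val
      rw [List.count_eq_one_of_mem List.nodup_range (List.mem_range.2 μ.isLt)] at h1
      rw [← show List.replicate 1 μ.val = [μ.val] from rfl, ← h1]
      congr 1
    rw [this]
    rfl
  simp only [delivered, key]
  induction List.finRange m with
  | nil => rfl
  | cons a l ih => rw [List.flatMap_cons, ih]; rfl

theorem sum_map_range (k : ℕ) (f : ℕ → ℕ) : ((List.range k).map f).sum = ∑ j ∈ range k, f j := by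
  induction k with
  | zero => rfl
  | succ k ih => rw [List.range_succ, List.map_append, List.sum_append, ih, sum_range_succ]; simp

/-- Lengths, multiplicities and totals of an inbox are all sums over its words; here they become
double sums over senders and sent words. -/
theorem sum_map_delivered {m : ℕ} {c : Fin m → State} {k : Fin m → ℕ} {g : Fin m → ℕ → ℕ × ℕ}
    (h : ∀ ν, (c ν).outbox = (List.range (k ν)).map (g ν)) (μ : Fin m) (f : ℕ → ℕ) :
    ((delivered c μ).map f).sum =
      ∑ ν, ∑ j ∈ range (k ν), if (g ν j).1 = μ then f (g ν j).2 else 0 := by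
  have aux : ∀ l : List (ℕ × ℕ), (((l.filter (fun x => x.1 = μ.val)).map Prod.snd).map f).sum =
      (l.map fun p => if p.1 = μ.val then f p.2 else 0).sum := by
    intro l
    induction l with
    | nil => rfl
    | cons p l ih =>
      by_cases hp : p.1 = μ.val
      · rw [List.filter_cons_of_pos (by simpa using hp)]
        simp only [List.map_cons, List.sum_cons, ih, if_pos hp]
      · rw [List.filter_cons_of_neg (by simpa using hp)]
        simp only [List.map_cons, List.sum_cons, ih, if_neg hp, zero_add]
  have aux2 : ∀ l : List (Fin m), ((l.flatMap fun ν =>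
      ((c ν).outbox.filter (fun x => x.1 = μ.val)).map Prod.snd).map f).sum =
      (l.map fun ν => ∑ j ∈ range (k ν), if (g ν j).1 = μ then f (g ν j).2 else 0).sum := by
    intro l
    induction l with
    | nil => rfl
    | cons ν l ih =>
      rw [List.flatMap_cons, List.map_append, List.sum_append, ih, List.map_cons, List.sum_cons,
        aux, h ν, List.map_map, sum_map_range]
      rfl
  rw [delivered, aux2, Fin.sum_univ_def]

theorem mem_delivered {m : ℕ} {c : Fin m → State} {k : Fin m → ℕ} {g : Fin m → ℕ → ℕ × ℕ}
    (h : ∀ ν, (c ν).outbox = (List.range (k ν)).map (g ν)) {μ : Fin m} {x : ℕ}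
    (hx : x ∈ delivered c μ) : ∃ ν, ∃ j < k ν, (g ν j).1 = μ ∧ (g ν j).2 = x := by
  simp only [delivered, List.mem_flatMap, h] at hx
  obtain ⟨ν, -, hx⟩ := hx
  simp only [List.mem_map, List.mem_filter, List.mem_range] at hx
  obtain ⟨p, ⟨⟨j, hj, rfl⟩, hp⟩, rfl⟩ := hx
  exact ⟨ν, j, hj, by simpa using hp, rfl⟩

theorem getD_mem_or {l : List ℕ} (i : ℕ) : l.getD i 0 ∈ l ∨ l.getD i 0 = 0 := by
  rcases Nat.lt_or_ge i l.length with h | h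
  · left
    rw [List.getD_eq_getElem _ _ h]
    exact List.getElem_mem h
  · exact .inr (List.getD_eq_default _ _ h)

theorem getD_map_finRange {m : ℕ} (f : ℕ → ℕ) (hf : ∀ i, m ≤ i → f i = 0) (i : ℕ) :
    ((List.finRange m).map fun ν => f ν.val).getD i 0 = f i := by
  rcases Nat.lt_or_ge i m with h | h
  · rw [List.getD_eq_getElem _ _ (by simpa using h)]
    simp
  · rw [List.getD_eq_default _ _ (by simpa using h), hf i h]

theorem sum_getD (l : List ℕ) (f : ℕ → ℕ) :
    ∑ i ∈ range l.length, f (l.getD i 0) = (l.map f).sum := by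
  induction l with
  | nil => rfl
  | cons a l ih =>
    rw [List.length_cons, sum_range_succ', List.map_cons, List.sum_cons, ← ih, add_comm]
    rfl

theorem hist_getD (l : List ℕ) (a v : ℕ → ℕ) (b : ℕ) :
    hist l.length (fun i => a (l.getD i 0)) (fun i => v (l.getD i 0)) b =
      (l.map fun x => if a x = b then v x else 0).sum :=
  sum_getD l fun x => if a x = b then v x else 0

/-! ### Ranks, block weights and the load of the routing. -/

theorem hist_succ_self (a : ℕ → ℕ) (j : ℕ) :
    hist (j + 1) a (fun _ => 1) (a j) = hist j a (fun _ => 1) (a j) + 1 := by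
  rw [hist, sum_range_succ, if_pos rfl, ← hist]

theorem sum_hist_le (k : ℕ) (a : ℕ → ℕ) (c : ℕ) :
    ∑ b ∈ range c, hist k a (fun _ => 1) b ≤ k := by
  simp only [hist]
  rw [sum_comm]
  refine (sum_le_sum (g := fun _ => 1) fun i _ => ?_).trans (by simp)
  rw [sum_ite_eq]
  split_ifs <;> omega

/-- Among the occurrences of `b` in a sequence, those whose rank has a given residue modulo `g`. -/
theorem card_rank_mod_le (k : ℕ) (a : ℕ → ℕ) (b g r : ℕ) :
    #{j ∈ range k | a j = b ∧ hist j a (fun _ => 1) b % g = r} ≤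
      hist k a (fun _ => 1) b / g + 1 := by
  -- The rank strictly increases along the occurrences of `b`, so it determines the position.
  have hlt : ∀ i j, i < j → a i = b → hist i a (fun _ => 1) b < hist j a (fun _ => 1) b := by
    rintro i j hij rfl
    have := hist_mono (a := a) (v := fun _ => 1) (show i + 1 ≤ j from hij) (a i)
    rw [hist_succ_self] at this
    omega
  rw [← card_range (hist k a (fun _ => 1) b / g + 1)]
  -- With the residue fixed, the quotient determines the rank.
  refine card_le_card_of_injOn (fun j => hist j a (fun _ => 1) b / g) ?_ ?_
  · intro j hj
    simp only [coe_filter, mem_range, Set.mem_ofPred_eq] at hj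
    simp only [coe_range, Set.mem_Iio]
    exact Nat.lt_succ_of_le (Nat.div_le_div_right (hist_mono hj.1.le b))
  · intro i hi j hj hij
    simp only [coe_filter, mem_range, Set.mem_ofPred_eq] at hi hj hij
    have : hist i a (fun _ => 1) b = hist j a (fun _ => 1) b := by
      rw [← Nat.div_add_mod (hist i a (fun _ => 1) b) g, hij, hi.2.2, ← hj.2.2, Nat.div_add_mod]
    rcases lt_trichotomy i j with h | h | h
    · exact absurd this (hlt i j h hi.2.1).ne
    · exact h
    · exact absurd this (hlt j i h hj.2.1).ne'

theorem sum_div_le {ι : Type*} (s : Finset ι) (f : ι → ℕ) (g : ℕ) :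
    ∑ i ∈ s, f i / g ≤ (∑ i ∈ s, f i) / g := by
  rcases Nat.eq_zero_or_pos g with rfl | hg
  · simp
  · rw [Nat.le_div_iff_mul_le hg, sum_mul]
    exact sum_le_sum fun i _ => Nat.div_mul_le_self _ _

/-- The number of keys in block `b` on all machines together. -/
def blockWeight {m : ℕ} (B : ℕ) (len : Fin m → ℕ) (key : Fin m → ℕ → ℕ) (b : ℕ) : ℕ :=
  ∑ ν, hist (len ν) (fun i => key ν i / B) (fun _ => 1) b

/-- The number of occurrences of the key `v` on all machines together. -/
def occurrences {m : ℕ} (len : Fin m → ℕ) (key : Fin m → ℕ → ℕ) (v : ℕ) : ℕ :=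
  ∑ ν, ∑ j ∈ range (len ν), if key ν j = v then 1 else 0

theorem occurrences_le {m : ℕ} (len : Fin m → ℕ) (key : Fin m → ℕ → ℕ) (v : ℕ) :
    occurrences len key v ≤ ∑ ν, len ν :=
  sum_le_sum fun ν _ => hist_le (k := len ν) (a := key ν) (v := fun _ => 1) (fun _ => le_rfl) v

theorem sum_blockWeight_le {m : ℕ} (B : ℕ) (len : Fin m → ℕ) (key : Fin m → ℕ → ℕ) (c : ℕ) :
    ∑ b ∈ range c, blockWeight B len key b ≤ ∑ ν, len ν := by
  simp only [blockWeight]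
  rw [sum_comm]
  exact sum_le_sum fun ν _ => sum_hist_le _ _ _

theorem firstMachine_le {m : ℕ} (B : ℕ) (len : Fin m → ℕ) (key : Fin m → ℕ → ℕ) (c : ℕ) :
    firstMachine B (blockWeight B len key) c ≤ (∑ ν, len ν) / B + c := by
  rw [firstMachine, sum_add_distrib, sum_const, card_range, smul_eq_mul, mul_one]
  exact Nat.add_le_add_right ((sum_div_le _ _ _).trans
    (Nat.div_le_div_right (sum_blockWeight_le B len key c))) c

/-- The blocks up to that of the key use at most `2 * n / B + n / B + 1 ≤ 3 * n / B + 1 ≤ m`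
machines: `2 * n` for the keys and `n` for the one extra machine per block. This explains the factor
`3` in `blockLength`. -/
theorem route_lt_machines {m n B : ℕ} {len : Fin m → ℕ} {key : Fin m → ℕ → ℕ}
    (hkey : ∀ ν j, key ν j ≤ n) (hlen : ∑ ν, len ν ≤ 2 * n) (hB : 3 * n < m * B) (ν : Fin m)
    (j : ℕ) : route B (blockWeight B len key) (key ν) j < m := by
  have h1 := route_lt B (blockWeight B len key) (key ν) j
  have h2 := firstMachine_le B len key (key ν j / B + 1)
  have h3 : (∑ ν, len ν) / B ≤ 2 * n / B := Nat.div_le_div_right hlen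
  have h4 : key ν j / B ≤ n / B := Nat.div_le_div_right (hkey ν j)
  have hBpos : 0 < B := by
    rcases Nat.eq_zero_or_pos B with h | h
    · rw [h] at hB; omega
    · exact h
  have h5 : 2 * n / B + n / B ≤ 3 * n / B := by
    rw [Nat.le_div_iff_mul_le hBpos, add_mul]
    have h6 := Nat.div_mul_le_self (2 * n) B
    have h7 := Nat.div_mul_le_self n B
    omega
  have h8 : 3 * n / B < m := Nat.div_lt_of_lt_mul (by rwa [mul_comm B m])
  omega

/-- The keys sent to one machine lie in one block. -/
theorem block_eq_of_route_eq {B : ℕ} {W key key' : ℕ → ℕ} {j j' : ℕ}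
    (h : route B W key j = route B W key' j') : key j / B = key' j' / B := by
  -- Different blocks own disjoint intervals of machines, in increasing order.
  have aux : ∀ {key key' : ℕ → ℕ} {j j' : ℕ}, key j / B < key' j' / B →
      route B W key j < route B W key' j' := by
    intro key key' j j' hlt
    exact (route_lt B W key j).trans_le ((firstMachine_mono B W hlt).trans (Nat.le_add_right _ _))
  rcases lt_trichotomy (key j / B) (key' j' / B) with h' | h' | h'
  · exact absurd h (aux h').ne
  · exact h'
  · exact absurd h (aux h').ne'

/-- All keys sent to `V` lie in one block `b`, served by `g = W b / B + 1` machines. Dealing in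
turn, a sender with `h` such keys gives `V` at most `h / g + 1`. These sum to at most `W b / g + m`,
and `W b ≤ g * B`. -/
theorem card_route_le {m B : ℕ} (hB : 0 < B) (len : Fin m → ℕ) (key : Fin m → ℕ → ℕ) (V : ℕ) :
    ∑ ν, ∑ j ∈ range (len ν), (if route B (blockWeight B len key) (key ν) j = V then 1 else 0) ≤
      B + m := by
  set W := blockWeight B len key with hW
  simp only [← sum_filter, sum_const, smul_eq_mul, mul_one]
  by_cases hex : ∃ ν j, route B W (key ν) j = V
  · obtain ⟨ν₀, j₀, h₀⟩ := hex
    set b := key ν₀ j₀ / B with hb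
    have hsub : ∀ ν, #{j ∈ range (len ν) | route B W (key ν) j = V} ≤
        hist (len ν) (fun i => key ν i / B) (fun _ => 1) b / (W b / B + 1) + 1 := by
      intro ν
      refine le_trans (card_le_card fun j hj => ?_) (card_rank_mod_le (len ν)
        (fun i => key ν i / B) b (W b / B + 1) (V - firstMachine B W b))
      simp only [mem_filter] at hj ⊢
      have hj2 : key ν j / B = b := block_eq_of_route_eq (hj.2.trans h₀.symm)
      refine ⟨hj.1, hj2, ?_⟩
      rw [← hj.2, route, hj2]
      omega
    refine (sum_le_sum fun ν _ => hsub ν).trans ?_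
    rw [sum_add_distrib, sum_const, card_univ, Fintype.card_fin, smul_eq_mul, mul_one]
    refine Nat.add_le_add_right ((sum_div_le _ _ _).trans ?_) m
    change W b / _ ≤ B
    refine Nat.div_le_of_le_mul ?_
    have := Nat.div_add_mod (W b) B
    have h2 := Nat.mod_lt (W b) hB
    calc W b ≤ B * (W b / B) + B := by omega
      _ = _ := by ring
  · push Not at hex
    simp [hex]

/-! ### From tables of offsets to totals. -/

theorem card_mod_eq_le (m t r : ℕ) : #{o ∈ range (m * t) | o % m = r} ≤ t := by
  conv_rhs => rw [← card_range t]
  refine card_le_card_of_injOn (· / m) ?_ ?_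
  · intro o ho
    simp only [coe_filter, mem_range, Set.mem_ofPred_eq] at ho
    simp only [coe_range, Set.mem_Iio]
    exact Nat.div_lt_of_lt_mul ho.1
  · intro i hi j hj hij
    simp only [coe_filter, mem_range, Set.mem_ofPred_eq] at hi hj hij
    rw [← Nat.div_add_mod i m, hij, hi.2, ← hj.2, Nat.div_add_mod]

/-- If all words of an inbox lie in one block, then its table of offsets determines the number of
occurrences of each word. -/
theorem sum_offset_counts {l : List ℕ} {B : ℕ} (hB : 0 < B)
    (hl : ∀ x ∈ l, x / B = l.getD 0 0 / B) (v : ℕ) :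
    ∑ o ∈ range B, (if l.getD 0 0 / B * B + o = v then
      hist l.length (fun i => l.getD i 0 % B) (fun _ => 1) o else 0) =
      (l.map fun x => if x = v then 1 else 0).sum := by
  rw [← sum_getD l fun x => if x = v then 1 else 0]
  -- After exchanging the sums, word `i` contributes only at its own offset, and there the common
  -- block number restores the word.
  have h1 : ∀ o, (if l.getD 0 0 / B * B + o = v then
      hist l.length (fun i => l.getD i 0 % B) (fun _ => 1) o else 0) =
      ∑ i ∈ range l.length, if l.getD i 0 % B = o then
        (if l.getD 0 0 / B * B + o = v then 1 else 0) else 0 := by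
    intro o
    split_ifs with h
    · rfl
    · simp
  simp only [h1]
  rw [sum_comm]
  refine sum_congr rfl fun i hi => ?_
  rw [sum_ite_eq, if_pos (mem_range.2 (Nat.mod_lt _ hB))]
  have h2 := hl (l.getD i 0) (by
    rw [List.getD_eq_getElem _ _ (mem_range.1 hi)]
    exact List.getElem_mem _)
  rw [← h2, Nat.div_add_mod']

/-- The outcome of the last round: what machine `μ` adds up is the number of occurrences of the keys
that are `μ` modulo `m`. -/
theorem total_delivered {m B t : ℕ} (hB : 0 < B) (hBt : B = m * t) {c : Fin m → State}
    {l : Fin m → List ℕ} (hl : ∀ ν, ∀ x ∈ l ν, x / B = (l ν).getD 0 0 / B)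
    (hlm : ∀ ν, (l ν).getD 0 0 / B < m)
    (h : ∀ ν, (c ν).outbox = (List.range B).map fun o => (o % m, countWord m B (l ν) o))
    (μ : Fin m) (a : ℕ) :
    total m B (delivered c μ) a =
      ∑ ν, ((l ν).map fun x => if x = a * m + μ then 1 else 0).sum := by
  have hm : 0 < m := μ.pos
  rw [total, hist_getD (delivered c μ) (fun x => x % (m * B) / m) (fun x => x / (m * B)),
    sum_map_delivered h]
  refine sum_congr rfl fun ν _ => ?_
  rw [← sum_offset_counts hB (hl ν)]
  refine sum_congr rfl fun o ho => ?_
  rw [mem_range] at ho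
  set b := (l ν).getD 0 0 / B with hb
  have hlt : b * B + o < m * B := by
    have : (b + 1) * B ≤ m * B := Nat.mul_le_mul_right B (hlm ν)
    rw [add_mul, one_mul] at this
    omega
  -- The packed word decodes because the key part is below `m * B`.
  have h1 : countWord m B (l ν) o % (m * B) = b * B + o := by
    rw [countWord, add_comm, Nat.add_mul_mod_self_right, Nat.mod_eq_of_lt hlt]
  have h2 : countWord m B (l ν) o / (m * B) =
      hist (l ν).length (fun i => (l ν).getD i 0 % B) (fun _ => 1) o := by
    rw [countWord, add_comm, Nat.add_mul_div_right _ _ (by omega), Nat.div_eq_of_lt hlt, zero_add]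
  simp only [h1, h2]
  -- This is why `B` is a multiple of `m`: the offset alone determines the machine responsible for
  -- the key.
  have h3 : (b * B + o) % m = o % m := by
    rw [hBt, ← mul_assoc, mul_comm b m, mul_assoc, Nat.mul_add_mod]
  have h4 := Nat.div_add_mod (b * B + o) m
  by_cases hv : b * B + o = a * m + μ
  · have h5 : o % m = μ := by
      rw [← h3, hv, add_comm, Nat.add_mul_mod_self_right, Nat.mod_eq_of_lt μ.isLt]
    have h6 : (b * B + o) / m = a := by
      rw [hv, add_comm, Nat.add_mul_div_right _ _ hm, Nat.div_eq_of_lt μ.isLt, zero_add]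
    rw [if_pos h5, if_pos h6, if_pos hv]
  · rw [if_neg hv]
    split_ifs with h5 h6
    · exfalso
      apply hv
      rw [h3, h5, h6] at h4
      rw [← h4, mul_comm]
    · rfl
    · rfl

theorem length_delivered {m : ℕ} {c : Fin m → State} {k : Fin m → ℕ} {g : Fin m → ℕ → ℕ × ℕ}
    (h : ∀ ν, (c ν).outbox = (List.range (k ν)).map (g ν)) (μ : Fin m) :
    (delivered c μ).length = ∑ ν, ∑ j ∈ range (k ν), if (g ν j).1 = μ then 1 else 0 := by
  rw [← sum_map_delivered h μ fun _ => 1]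
  simp

end MPC

/-! ### Degrees in a rooted tree. -/

namespace NumberedTree

open Finset

variable {n : ℕ} (T : NumberedTree n)

theorem eq_root_of_parent_eq {v : Fin n} (h : T.parent v = v) : v = T.root := by
  obtain ⟨k, hk⟩ := T.reaches_root v
  rwa [Function.iterate_fixed h] at hk

/-- The iterates of `u` never leave the cycle, but they reach the root. -/
theorem eq_root_of_two_cycle {u v : Fin n} (huv : T.parent u = v) (hvu : T.parent v = u) :
    u = T.root ∨ v = T.root := by
  obtain ⟨k, hk⟩ := T.reaches_root u
  have : ∀ k, T.parent^[k] u = u ∨ T.parent^[k] u = v := by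
    intro k
    induction k with
    | zero => exact .inl rfl
    | succ k ih =>
      rw [Function.iterate_succ_apply']
      rcases ih with h | h
      · exact .inr (by rw [h]; exact huv)
      · exact .inl (by rw [h]; exact hvu)
  rw [← hk]
  exact (this k).imp Eq.symm Eq.symm

/-- The neighbours are the parent and the children. A parent that is also a child would form a
two-cycle avoiding the root. -/
theorem degree_eq (v : Fin n) :
    T.degree v = (if v = T.root then 0 else 1) + #{u | u ≠ T.root ∧ T.parent u = v} := by
  classical
  have hset : T.graph.neighborSet v =
      ↑((if v = T.root then ∅ else {T.parent v}) ∪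
        ({u | u ≠ T.root ∧ T.parent u = v} : Finset (Fin n))) := by
    ext u
    simp only [SimpleGraph.mem_neighborSet, graph, SimpleGraph.fromRel_adj, coe_union,
      Set.mem_union, mem_coe, mem_filter, mem_univ, true_and]
    constructor
    · rintro ⟨hne, h | h⟩
      · left
        rw [if_neg]
        · exact mem_singleton.2 h.symm
        · rintro rfl
          exact hne (T.parent_root.symm.trans h)
      · right
        refine ⟨?_, h⟩
        rintro rfl
        exact hne (h.symm.trans T.parent_root)
    · rintro (h | ⟨h1, h2⟩)
      · split_ifs at h with hv
        · simp at h
        · rw [mem_singleton] at h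
          exact ⟨fun he => hv (T.eq_root_of_parent_eq (h.symm.trans he.symm)), .inl h.symm⟩
      · exact ⟨fun he => h1 (T.eq_root_of_parent_eq (h2.trans he)), .inr h2⟩
  rw [degree, hset, Set.ncard_coe_finset, card_union_of_disjoint]
  · split_ifs <;> simp
  · split_ifs with hv
    · simp
    · rw [disjoint_singleton_left, mem_filter]
      rintro ⟨-, h1, h2⟩
      exact (T.eq_root_of_two_cycle rfl h2).elim hv h1

theorem parentIndex_le (v : Fin n) : T.parentIndex v ≤ n := by
  unfold parentIndex index
  split_ifs <;> omega

theorem index_le (v : Fin n) : index v ≤ n := v.isLt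

theorem index_inj {u v : Fin n} : index u = index v ↔ u = v := by
  simp [index, Fin.ext_iff]

theorem parentIndex_eq_index (u v : Fin n) :
    T.parentIndex u = index v ↔ u ≠ T.root ∧ T.parent u = v := by
  unfold parentIndex
  split_ifs with h
  · simp [index, h]
  · simp [index_inj, h]

theorem parentIndex_pos (u : Fin n) : 0 < T.parentIndex u ↔ u ≠ T.root := by
  unfold parentIndex index
  split_ifs with h <;> simp [h]

end NumberedTree

/-! ### The keys of the tree input and the residue classes of vertices. -/

namespace MPC

open Finset NumberedTree

theorem getD_le_of_forall {l : List ℕ} {n : ℕ} (h : ∀ x ∈ l, x ≤ n) (i : ℕ) : l.getD i 0 ≤ n := by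
  rcases getD_mem_or (l := l) i with hi | hi
  · exact h _ hi
  · omega

/-- Position `i / 2 * 2 + 1` is that of the parent word in the pair containing word `i`, and
dropping a whole pair preserves this pairing. -/
theorem sum_inputKey {α : Type*} (f : ℕ → ℕ) (a b : α → ℕ) (l : List α) :
    ∑ j ∈ range (l.flatMap fun u => [a u, b u]).length,
        f (inputKey (l.flatMap fun u => [a u, b u]) j) =
      (l.map fun u => f (a u * if 0 < b u then 1 else 0) + f (b u)).sum := by
  induction l with
  | nil => rfl
  | cons u l ih =>
    have hlen : ((u :: l).flatMap fun u => [a u, b u]).length =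
        (l.flatMap fun u => [a u, b u]).length + 1 + 1 := by simp
    rw [hlen, sum_range_succ', sum_range_succ', List.map_cons, List.sum_cons, ← ih]
    have h2 : ∀ j, inputKey ((u :: l).flatMap fun u => [a u, b u]) (j + 1 + 1) =
        inputKey (l.flatMap fun u => [a u, b u]) j := by
      intro j
      have : (j + 1 + 1) / 2 * 2 + 1 = j / 2 * 2 + 1 + 1 + 1 := by omega
      rw [inputKey, this]
      rfl
    have h0 : inputKey ((u :: l).flatMap fun u => [a u, b u]) 0 =
        a u * if 0 < b u then 1 else 0 := rfl
    have h1 : inputKey ((u :: l).flatMap fun u => [a u, b u]) (0 + 1) = b u := by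
      change b u * (if 0 < b u then 1 else 0) = b u
      split_ifs <;> omega
    rw [h0, h1]
    simp only [h2]
    omega

theorem sum_map_eq_sum_count {α : Type*} [Fintype α] [DecidableEq α] (l : List α) (F : α → ℕ) :
    (l.map F).sum = ∑ u, l.count u * F u := by
  induction l with
  | nil => simp
  | cons a l ih =>
    simp only [List.map_cons, List.sum_cons, ih, List.count_cons, add_mul, sum_add_distrib]
    rw [add_comm]
    congr 1
    simp [beq_iff_eq]

theorem IsDistribution.sum_map {n m : ℕ} {part : Fin m → List (Fin n)} (h : IsDistribution part)
    (F : Fin n → ℕ) : ∑ μ, ((part μ).map F).sum = ∑ v, F v := by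
  simp only [sum_map_eq_sum_count]
  rw [sum_comm]
  refine sum_congr rfl fun v _ => ?_
  rw [← sum_mul, h v, one_mul]

theorem length_treeInput {n m : ℕ} (T : NumberedTree n) (part : Fin m → List (Fin n)) (μ : Fin m) :
    (treeInput T part μ).length = 2 * (part μ).length := by
  simp [treeInput, List.length_flatMap, mul_comm]

theorem sum_length_treeInput {n m : ℕ} (T : NumberedTree n) {part : Fin m → List (Fin n)}
    (h : IsDistribution part) : ∑ μ, (treeInput T part μ).length = 2 * n := by
  have := h.sum_map fun _ => 2
  simpa [length_treeInput, mul_comm] using this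

theorem treeInput_getD_le {n m : ℕ} (T : NumberedTree n) (part : Fin m → List (Fin n)) (μ : Fin m)
    (i : ℕ) : (treeInput T part μ).getD i 0 ≤ n := by
  refine getD_le_of_forall (fun x hx => ?_) i
  simp only [treeInput, List.mem_flatMap, List.mem_cons, List.not_mem_nil, or_false] at hx
  obtain ⟨v, -, rfl | rfl⟩ := hx
  · exact index_le v
  · exact T.parentIndex_le v

/-- The degree of a vertex is the number of its occurrences as a key. -/
theorem occurrences_treeInput {n m : ℕ} (T : NumberedTree n) {part : Fin m → List (Fin n)}
    (h : IsDistribution part) (v : Fin n) :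
    occurrences (fun μ => (treeInput T part μ).length) (fun μ => inputKey (treeInput T part μ))
      (index v) = T.degree v := by
  have h1 := fun μ => sum_inputKey (fun x => if x = index v then 1 else 0) index T.parentIndex
    (part μ)
  refine (sum_congr rfl fun μ _ => h1 μ).trans ?_
  rw [h.sum_map, sum_add_distrib, T.degree_eq]
  -- The first words of the pairs account for the edge from `v` to its parent, the second words for
  -- its children. The dummy key is never counted, as indices are positive.
  congr 1
  · rw [Fintype.sum_eq_single v]
    · simp only [T.parentIndex_pos]
      by_cases hv : v = T.root
      · simp [hv, index]
      · simp [hv]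
    · intro u hu
      rw [if_neg]
      split_ifs
      · rwa [mul_one, index_inj]
      · simp [index]
  · simp only [T.parentIndex_eq_index, card_filter]

/-- The keys of residue `μ` modulo `m` that are vertices. -/
def residueVertices (n m μ : ℕ) : List (Fin n) :=
  (List.range (n / m + 1)).filterMap fun a =>
    if h : 0 < a * m + μ ∧ a * m + μ ≤ n then some ⟨a * m + μ - 1, by omega⟩ else none

theorem flatMap_residueVertices {n m μ : ℕ} (d : ℕ → ℕ) (f : Fin n → ℕ)
    (h : ∀ a (v : Fin n), index v = a * m + μ → d a = f v) :
    ((List.range (n / m + 1)).flatMap fun a =>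
      if 0 < a * m + μ ∧ a * m + μ ≤ n then [a * m + μ, d a] else []) =
    (residueVertices n m μ).flatMap fun v => [index v, f v] := by
  unfold residueVertices
  induction List.range (n / m + 1) with
  | nil => rfl
  | cons a l ih =>
    rw [List.flatMap_cons, ih, List.filterMap_cons]
    by_cases hc : 0 < a * m + μ ∧ a * m + μ ≤ n
    · have hi : index (⟨a * m + μ - 1, by omega⟩ : Fin n) = a * m + μ := by
        simp only [index]; omega
      rw [if_pos hc, dif_pos hc, h a _ hi]
      change _ = [index _, f _] ++ _
      rw [hi]
      rfl
    · rw [if_neg hc, dif_neg hc]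
      rfl

theorem count_residueVertices {n m : ℕ} (hm : 0 < m) (μ : ℕ) (hμ : μ < m) (v : Fin n) :
    (residueVertices n m μ).count v = if index v % m = μ then 1 else 0 := by
  have hg : ∀ a, (if h : 0 < a * m + μ ∧ a * m + μ ≤ n then
      some (⟨a * m + μ - 1, by omega⟩ : Fin n) else none) = some v ↔ a * m + μ = index v := by
    intro a
    have := v.isLt
    unfold index
    split_ifs with hc
    · rw [Option.some_inj, Fin.ext_iff]
      change a * m + μ - 1 = _ ↔ _
      omega
    · constructor
      · intro h
        exact absurd h (by simp)
      · omega
  rw [residueVertices, List.count_filterMap]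
  rw [List.countP_congr (q := fun a => decide (a * m + μ = index v)) fun a _ => by
    rw [beq_iff_eq, hg, decide_eq_true_eq]]
  split_ifs with h
  · have hv := Nat.div_add_mod (index v) m
    have heq : ∀ a, a * m + μ = index v ↔ a = index v / m := by
      intro a
      constructor
      · intro ha
        rw [← ha, add_comm, Nat.add_mul_div_right _ _ hm, Nat.div_eq_of_lt hμ, zero_add]
      · rintro rfl
        rw [mul_comm, ← h, hv]
    simp only [heq]
    have hlt : index v / m < n / m + 1 := Nat.lt_succ_of_le (Nat.div_le_div_right (index_le v))
    exact List.count_eq_one_of_mem List.nodup_range (List.mem_range.2 hlt)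
  · rw [List.countP_eq_zero]
    intro a _ ha
    apply h
    rw [decide_eq_true_eq] at ha
    rw [← ha, add_comm, Nat.add_mul_mod_self_right, Nat.mod_eq_of_lt hμ]

theorem isDistribution_residueVertices {n m : ℕ} (hm : 0 < m) :
    IsDistribution fun μ : Fin m => residueVertices n m μ := by
  intro v
  simp only [count_residueVertices hm _ (Fin.isLt _)]
  rw [Fintype.sum_eq_single ⟨index v % m, Nat.mod_lt _ hm⟩]
  · simp
  · intro μ hμ
    rw [if_neg]
    rintro h
    exact hμ (Fin.ext h.symm)

/-! ### Composition of the five rounds. -/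

/-- The programs of the five rounds. -/
def degreeAlgorithm : Fin 5 → Prog := ![countProg, totalProg, routeProg, gatherProg, outputProg]

theorem exists_config {m : ℕ} {env : Fin m → Env} {p : Prog} {c : Fin m → State}
    {Q : Fin m → State → Prop} (h : ∀ μ, WP (env μ) p (Q μ) (c μ).startRound) :
    ∃ c' : Fin m → State, (∀ μ, Exec (env μ) p (c μ).startRound (c' μ)) ∧ ∀ μ, Q μ (c' μ) := by
  choose c' h1 h2 using h
  exact ⟨c', h1, h2⟩

/-- `blockLength n m` is `m` times the least integer exceeding the real quotient `3 n / m²`. -/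
theorem lt_mul_blockLength {n m : ℕ} (hm : 0 < m) : 3 * n < m * blockLength n m := by
  have := Nat.lt_mul_div_succ (3 * n) (Nat.mul_pos hm hm)
  rwa [mul_assoc] at this

theorem length_le_of_map_range {α : Type*} {l : List α} {k U : ℕ} {f : ℕ → α}
    (h : l = (List.range k).map f) (hk : k ≤ U) : l.length ≤ U := by
  rw [h]; simpa using hk

theorem blockWeight_eq_zero {m n B : ℕ} {len : Fin m → ℕ} {key : Fin m → ℕ → ℕ}
    (hkey : ∀ ν j, key ν j ≤ n) (hB : n < m * B) (b : ℕ) (hb : m ≤ b) :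
    blockWeight B len key b = 0 := by
  refine sum_eq_zero fun ν _ => sum_eq_zero fun j _ => if_neg fun h => ?_
  have : key ν j / B < m := Nat.div_lt_of_lt_mul (by rw [mul_comm]; exact (hkey ν j).trans_lt hB)
  change key ν j / B = b at h
  omega

/-- `U` bounds the inboxes and array lengths in all rounds. The term `U * (m * blockLength n m)` in
`hbig` leaves room for the packed counts. -/
theorem exists_run {n m w U : ℕ} (T : NumberedTree n) {part : Fin m → List (Fin n)}
    (hpart : IsDistribution part) (hm : 0 < m) (hlenU : ∀ μ, 2 * (part μ).length ≤ U)
    (hBU : blockLength n m + m ≤ U) (hnU : n / m + 1 ≤ U)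
    (hbig : U * (m * blockLength n m) + 8 * U + 6 * n + m * m + 9 < 2 ^ w) (ω : Tapes m w) :
    ∃ c : ℕ → Fin m → State, IsRun n degreeAlgorithm (treeInput T part) ω c ∧
      OutputsDegrees T (c 5) ∧ ∀ (i : Fin 5) (μ : Fin m),
        spaceUsed (treeInput T part) c i μ ≤ 100 * U + 100 ∧ timeUsed c i μ ≤ 100 * U + 100 := by
  set input := treeInput T part with hinput
  set B := blockLength n m with hBdef
  set len : Fin m → ℕ := fun μ => (input μ).length with hlendef
  set key : Fin m → ℕ → ℕ := fun μ => inputKey (input μ) with hkeydef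
  have h3B : 3 * n < m * B := lt_mul_blockLength hm
  have hBpos : 0 < B := by
    rcases Nat.eq_zero_or_pos B with h | h
    · rw [h] at h3B; omega
    · exact h
  have hin : ∀ μ i, (input μ).getD i 0 ≤ n := treeInput_getD_le T part
  have hkey : ∀ ν j, key ν j ≤ n := fun ν => inputKey_le (hin ν)
  have hlen : ∀ μ, len μ ≤ U := fun μ => by
    rw [hlendef, hinput]
    simpa only [length_treeInput] using hlenU μ
  have hsum : ∑ ν, len ν = 2 * n := sum_length_treeInput T hpart
  let tape : Fin m → ℕ → ℕ := fun μ j => (ω (μ, j)).val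
  set W := blockWeight B len key with hWdef
  have hW : ∀ b, W b ≤ 2 * n := fun b => by
    rw [← hsum]
    exact (single_le_sum (fun _ _ => Nat.zero_le _) (self_mem_range_succ b)).trans
      (sum_blockWeight_le B len key (b + 1))
  -- counting
  obtain ⟨c1, hc1, hQ1⟩ := exists_config (env := fun μ => ⟨w, input μ, tape μ⟩)
    (c := initState n m) fun μ => countProg_spec (env := ⟨w, input μ, tape μ⟩) (U := U) (n := n) μ
      (hin μ) (by omega) (hlen μ) (by omega) (by change n < m * B; omega)
      (by change _ < 2 ^ w; omega)
      (by change _ < 2 ^ w; omega) (by change _ < 2 ^ w; omega)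
  have hI1 := delivered_broadcast (c := c1)
    (f := fun ν => hist (len ν) (fun i => key ν i / B) (fun _ => 1)) fun ν => (hQ1 ν).2.1
  have hsum1 : ∀ μ : Fin m, ∑ i ∈ range m, (delivered c1 μ).getD i 0 = W μ := by
    intro μ
    have hl : (delivered c1 μ).length = m := by rw [hI1]; simp
    have := sum_getD (delivered c1 μ) id
    rw [hl] at this
    rw [hWdef, blockWeight, Fin.sum_univ_def, ← hI1]
    simpa using this
  -- totals
  obtain ⟨c2, hc2, hQ2⟩ := exists_config (env := fun μ => ⟨w, delivered c1 μ, tape μ⟩)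
    (c := c1) fun μ => totalProg_spec (env := ⟨w, delivered c1 μ, tape μ⟩) (U := U)
      (hQ1 μ).1 (by omega) (by change _ < 2 ^ w; omega)
      (fun i => by
        change (delivered c1 μ).getD i 0 < 2 ^ w
        have : (delivered c1 μ).getD i 0 ≤ U := by
          refine getD_le_of_forall (fun x hx => ?_) i
          rw [hI1] at hx
          obtain ⟨ν, -, rfl⟩ := List.mem_map.1 hx
          exact (hist_le (fun _ => le_rfl) _).trans (hlen ν)
        omega)
      (by
        change ∑ i ∈ range m, (delivered c1 μ).getD i 0 < 2 ^ w
        rw [hsum1]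
        have := hW μ
        omega)
  have hI2 : ∀ μ, delivered c2 μ = (List.finRange m).map fun ν => W ν.val := by
    refine delivered_broadcast (c := c2) (f := fun ν _ => W ν) fun ν => ?_
    rw [(hQ2 ν).2.1]
    change (List.range m).map (fun b => (b, ∑ i ∈ range m, (delivered c1 ν).getD i 0)) = _
    rw [hsum1]
  have hgetD2 : ∀ μ, (fun i => (delivered c2 μ).getD i 0) = W := by
    intro μ
    funext i
    -- Past position `m` the default `0` is the correct weight, since those blocks contain no key.
    rw [hI2, getD_map_finRange W (blockWeight_eq_zero hkey (by omega))]
  have hgetD2' : ∀ μ i, (delivered c2 μ).getD i 0 = W i := fun μ i => congrFun (hgetD2 μ) i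
  -- routing
  obtain ⟨c3, hc3, hQ3⟩ := exists_config (env := fun μ => ⟨w, delivered c2 μ, tape μ⟩)
    (c := c2) fun μ => routeProg_spec (env := ⟨w, delivered c2 μ, tape μ⟩) (U := U) (n := n)
      (hQ2 μ).1 (by omega) (hlen μ) (by omega) (by change _ < 2 ^ w; omega)
      (by change _ < 2 ^ w; omega) (hkey μ) (by change n < m * B; omega)
      (fun i => by
        change (delivered c2 μ).getD i 0 < 2 ^ w
        rw [hgetD2']
        have := hW i
        omega)
      (by
        change firstMachine B (fun i => (delivered c2 μ).getD i 0) m < 2 ^ w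
        rw [hgetD2]
        -- The table also assigns machines to empty blocks, so its last entries may exceed `m`. No
        -- key is routed there; only overflow has to be excluded.
        have h1 := firstMachine_le B len key m
        have h2 := Nat.div_le_self (∑ ν, len ν) B
        rw [← hWdef] at h1
        omega)
  have hout3 : ∀ ν, (c3 ν).outbox =
      (List.range (len ν)).map fun j => (route B W (key ν) j, key ν j) := by
    intro ν
    rw [(hQ3 ν).2.2.2.1]
    change (List.range (len ν)).map (fun j =>
      (route B (fun i => (delivered c2 ν).getD i 0) (key ν) j, key ν j)) = _
    rw [hgetD2]
  have hmem3 : ∀ μ, ∀ x ∈ delivered c3 μ, ∃ ν, ∃ j < len ν, route B W (key ν) j = μ ∧ key ν j = x :=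
    fun μ x hx => mem_delivered hout3 hx
  have hle3 : ∀ μ i, (delivered c3 μ).getD i 0 ≤ n := fun μ i =>
    getD_le_of_forall (fun x hx => by
      obtain ⟨ν, j, -, -, rfl⟩ := hmem3 μ x hx
      exact hkey ν j) i
  have hlen3 : ∀ μ, (delivered c3 μ).length ≤ U := fun μ => by
    rw [length_delivered hout3]
    exact (card_route_le hBpos len key μ).trans hBU
  have hblock3 : ∀ μ, ∀ x ∈ delivered c3 μ, x / B = (delivered c3 μ).getD 0 0 / B := by
    intro μ x hx
    have h0 : (delivered c3 μ).getD 0 0 ∈ delivered c3 μ := by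
      rw [List.getD_eq_getElem _ _ (List.length_pos_of_mem hx)]
      exact List.getElem_mem _
    obtain ⟨ν, j, -, h1, rfl⟩ := hmem3 μ x hx
    obtain ⟨ν', j', -, h1', h2'⟩ := hmem3 μ _ h0
    rw [← h2']
    exact block_eq_of_route_eq (h1.trans h1'.symm)
  have hcount3 : ∀ v, ∑ μ, ((delivered c3 μ).map fun x => if x = v then 1 else 0).sum =
      occurrences len key v := by
    intro v
    simp only [sum_map_delivered hout3]
    rw [sum_comm]
    refine sum_congr rfl fun ν _ => ?_
    rw [sum_comm]
    refine sum_congr rfl fun j _ => ?_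
    rw [Fintype.sum_eq_single ⟨route B W (key ν) j, route_lt_machines hkey hsum.le h3B ν j⟩]
    · simp
    · intro μ hμ
      exact if_neg fun h => hμ (Fin.ext h.symm)
  -- gathering
  obtain ⟨c4, hc4, hQ4⟩ := exists_config (env := fun μ => ⟨w, delivered c3 μ, tape μ⟩)
    (c := c3) fun μ => gatherProg_spec (env := ⟨w, delivered c3 μ, tape μ⟩) (U := U) (n := n)
      (hQ3 μ).1 (hQ3 μ).2.1 (hQ3 μ).2.2.1 (hQ3 μ).2.2.2.2.1 (hQ3 μ).2.2.2.2.2.1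
      (hlen3 μ) (by omega) (by change B ≤ U; omega) hBpos (by change _ < 2 ^ w; omega) (hle3 μ)
      (by change U * (m * B) + n + B < 2 ^ w; omega)
  have hout4 : ∀ ν, (c4 ν).outbox =
      (List.range B).map fun o => (o % m, countWord m B (delivered c3 ν) o) := fun ν => (hQ4 ν).2.2.1
  -- Each of the `m` senders contributes at most `B / m` words.
  have hlen4 : ∀ μ, (delivered c4 μ).length ≤ B := fun μ => by
    rw [length_delivered hout4]
    simp only [← sum_filter, sum_const, smul_eq_mul, mul_one, card_univ, Fintype.card_fin]
    exact Nat.mul_le_mul_left m (card_mod_eq_le m _ μ)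
  have hlt4 : ∀ μ i, (delivered c4 μ).getD i 0 < 2 ^ w := by
    intro μ i
    refine (getD_le_of_forall (n := U * (m * B) + n + B) (fun x hx => ?_) i).trans_lt (by omega)
    obtain ⟨ν, o, ho, -, rfl⟩ := mem_delivered hout4 hx
    have h1 : (delivered c3 ν).getD 0 0 / B * B ≤ n := (Nat.div_mul_le_self _ _).trans (hle3 ν 0)
    have h2 := (hist_le (k := (delivered c3 ν).length)
      (a := fun i => (delivered c3 ν).getD i 0 % B) (v := fun _ => 1) (fun _ => le_rfl) o).trans
      (hlen3 ν)
    have h3 := Nat.mul_le_mul_right (m * B) h2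
    change countWord m B (delivered c3 ν) o ≤ _
    rw [countWord]
    omega
  have htot4 : ∀ (μ : Fin m) a, total m B (delivered c4 μ) a = occurrences len key (a * m + μ) := by
    intro μ a
    rw [← hcount3]
    refine total_delivered hBpos (t := 3 * n / (m * m) + 1) rfl hblock3 (fun ν => ?_) hout4 μ a
    refine Nat.div_lt_of_lt_mul ?_
    have := hle3 ν 0
    rw [mul_comm]
    omega
  -- output
  obtain ⟨c5, hc5, hQ5⟩ := exists_config (env := fun μ => ⟨w, delivered c4 μ, tape μ⟩)
    (c := c4) fun μ => outputProg_spec (env := ⟨w, delivered c4 μ, tape μ⟩) (U := U) (n := n)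
      (hQ4 μ).1 (hQ4 μ).2.1 (hQ4 μ).2.2.2.1 (hQ4 μ).2.2.2.2.1 μ.isLt
      ((hlen4 μ).trans (by omega)) (by omega) (by change B ≤ U; omega) hBpos hnU
      (by change _ < 2 ^ w; omega) (hlt4 μ)
      (by
        change m * B < 2 ^ w
        have := Nat.le_mul_of_pos_left (m * B) (show 0 < U by omega)
        omega)
      (by change _ < 2 ^ w; omega)
      (fun a => by
        change total m B (delivered c4 μ) a < 2 ^ w
        rw [htot4]
        have := occurrences_le len key (a * m + μ)
        omega)
  have hout5 : ∀ μ : Fin m, (c5 μ).output = (residueVertices n m μ).flatMap fun v =>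
      [NumberedTree.index v, T.degree v] := by
    intro μ
    rw [(hQ5 μ).1]
    refine flatMap_residueVertices _ _ fun a v hv => ?_
    change total m B (delivered c4 μ) a = _
    rw [htot4, ← hv]
    exact occurrences_treeInput T hpart v
  have hlen5 : ∀ μ, (c5 μ).output.length ≤ 2 * U := by
    intro μ
    have h1 : (residueVertices n m μ).length ≤ n / m + 1 :=
      (List.length_filterMap_le _ _).trans (by simp)
    rw [hout5]
    simp [List.length_flatMap]
    omega
  refine ⟨fun i => match i with
    | 0 => initState n m | 1 => c1 | 2 => c2 | 3 => c3 | 4 => c4 | _ => c5, ⟨rfl, ?_⟩, ?_, ?_⟩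
  · intro i μ
    fin_cases i
    exacts [hc1 μ, hc2 μ, hc3 μ, hc4 μ, hc5 μ]
  · exact ⟨fun μ => residueVertices n m μ, isDistribution_residueVertices hm, hout5⟩
  · intro i μ
    have hlI1 : (delivered c1 μ).length = m := by rw [hI1]; simp
    have hlI2 : (delivered c2 μ).length = m := by rw [hI2]; simp
    have hl4 := hlen4 μ
    have hl3 := hlen3 μ
    have hl5 := hlen5 μ
    have hl := hlen μ
    fin_cases i
    · obtain ⟨h1, h2, h3⟩ := hQ1 μ
      have h4 := length_le_of_map_range h2 (show m ≤ U by omega)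
      refine ⟨?_, h3⟩
      change (c1 μ).peak + len μ + (c1 μ).outbox.length + (c1 μ).output.length ≤ _
      have h5 := h1.peak
      rw [h1.output, List.length_nil]
      omega
    · obtain ⟨h1, h2, h3⟩ := hQ2 μ
      have h4 := length_le_of_map_range h2 (show m ≤ U by omega)
      refine ⟨?_, h3⟩
      change (c2 μ).peak + (delivered c1 μ).length + (c2 μ).outbox.length +
        (c2 μ).output.length ≤ _
      have h5 := h1.peak
      rw [h1.output, List.length_nil]
      omega
    · obtain ⟨-, -, -, -, h1, h3, h5⟩ := hQ3 μ
      have h4 := length_le_of_map_range (hout3 μ) hl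
      refine ⟨?_, h5⟩
      change (c3 μ).peak + (delivered c2 μ).length + (c3 μ).outbox.length +
        (c3 μ).output.length ≤ _
      rw [h1, List.length_nil]
      omega
    · obtain ⟨-, -, -, h1, h3, h5⟩ := hQ4 μ
      have h4 := length_le_of_map_range (hout4 μ) (show B ≤ U by omega)
      refine ⟨?_, h5⟩
      change (c4 μ).peak + (delivered c3 μ).length + (c4 μ).outbox.length +
        (c4 μ).output.length ≤ _
      rw [h1, List.length_nil]
      omega
    · obtain ⟨-, h1, h3, h5⟩ := hQ5 μ
      refine ⟨?_, h5⟩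
      change (c5 μ).peak + (delivered c4 μ).length + (c5 μ).outbox.length +
        (c5 μ).output.length ≤ _
      rw [h1, List.length_nil]
      omega

/-! ### Numerical bounds. -/

theorem blockLength_le (n m : ℕ) : blockLength n m ≤ 3 * n / m + m := by
  rw [blockLength, mul_add, mul_one, ← Nat.div_div_eq_div_mul]
  exact Nat.add_le_add_right (Nat.mul_div_le _ _) m

theorem IsDistribution.length_le {n m : ℕ} {part : Fin m → List (Fin n)} (h : IsDistribution part)
    (μ : Fin m) : (part μ).length ≤ n := by
  have h1 := h.sum_map fun _ => 1
  simp only [List.map_const', List.sum_replicate, smul_eq_mul, mul_one, sum_const, card_univ,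
    Fintype.card_fin] at h1
  refine le_of_le_of_eq ?_ h1
  exact single_le_sum (f := fun μ => (part μ).length) (fun _ _ => Nat.zero_le _) (mem_univ μ)

theorem eventually_log_pow_le (A : ℝ) (hA : 0 < A) (K : ℕ) :
    ∃ n₀ : ℕ, ∀ n : ℕ, n₀ ≤ n → A * Real.log n ^ K ≤ n := by
  have h := (Real.isLittleO_pow_log_id_atTop (n := K)).bound (inv_pos.2 hA)
  obtain ⟨n₀, hn₀⟩ := Filter.eventually_atTop.1 (tendsto_natCast_atTop_atTop.eventually h)
  refine ⟨n₀, fun n hn => ?_⟩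
  have h1 := (le_abs_self _).trans (hn₀ n hn)
  rw [id, Real.norm_natCast, inv_mul_eq_div, le_div_iff₀ hA] at h1
  linarith

theorem one_le_log {n : ℕ} (hn : 3 ≤ n) : 1 ≤ Real.log n := by
  rw [Real.le_log_iff_exp_le (by positivity)]
  have : (3 : ℝ) ≤ n := by exact_mod_cast hn
  linarith [Real.exp_one_lt_d9]

/-- A bound on the load of a machine that holds at most `L` vertices. -/
def loadBound (n m L : ℕ) : ℕ := 2 * min L n + blockLength n m + m + n / m + 1

theorem le_loadBound (n m L : ℕ) : 2 * min L n ≤ loadBound n m L ∧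
    blockLength n m + m ≤ loadBound n m L ∧ n / m + 1 ≤ loadBound n m L := by
  unfold loadBound
  generalize n / m = q
  omega

theorem loadBound_lt_two_pow {n m L : ℕ} (hn : 3 ≤ n) (hm : m ≤ n) :
    loadBound n m L * (m * blockLength n m) + 8 * loadBound n m L + 6 * n + m * m + 9 <
      2 ^ wordLength 8 n := by
  have hB : blockLength n m ≤ 4 * n := by
    have h1 := blockLength_le n m
    have h2 := Nat.div_le_self (3 * n) m
    omega
  -- The minimum with `n` in `loadBound` makes this independent of `L`, so the word length need not
  -- depend on the constants of the input assumption.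
  have hU : loadBound n m L ≤ 10 * n := by
    have h1 := Nat.div_le_self n m
    unfold loadBound
    omega
  have hmB : m * blockLength n m ≤ n * (4 * n) := Nat.mul_le_mul hm hB
  have h1 := Nat.mul_le_mul hU hmB
  have h2 := Nat.mul_le_mul hm hm
  have hlog : n < 2 ^ (Nat.log 2 n + 1) := Nat.lt_pow_succ_log_self (by norm_num) n
  have hw : n ^ 8 ≤ 2 ^ wordLength 8 n := by
    rw [wordLength, mul_comm, pow_mul]
    exact Nat.pow_le_pow_left hlog.le 8
  have h3 : 3 * 3 ≤ n * n := Nat.mul_le_mul hn hn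
  have h4 : 9 * n ≤ n * n * n := Nat.mul_le_mul_right n h3
  have h5 : 3 * (n * n) ≤ n * (n * n) := Nat.mul_le_mul_right _ hn
  -- The largest words are of order `40 * n ^ 3`; the remaining factor `n ^ 5 ≥ 3 ^ 5` absorbs the
  -- constants.
  have h6 : 3 ^ 5 * n ^ 3 ≤ n ^ 8 := by
    rw [show n ^ 8 = n ^ 5 * n ^ 3 by ring]
    exact Nat.mul_le_mul_right _ (Nat.pow_le_pow_left hn 5)
  have h7 : n * n * n = n ^ 3 := by ring
  have h8 : n * (n * n) = n ^ 3 := by ring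
  have h9 : 10 * n * (n * (4 * n)) = 40 * n ^ 3 := by ring
  omega

end MPC

/-! ### The main theorem. -/

theorem mainTheorem9 :
    -- a uniform algorithm with a constant number `R` of rounds and `O(log n)`-bit words
    ∃ (R κ a : ℕ) (A : Fin R → MPC.Prog),
    -- the constants in the model's assumptions that the input held by each machine, and the
    -- number of machines, are `Õ(n / m)`
    ∀ (C₀ : ℝ) (K₀ : ℕ),
    -- the memory size `S n m`, which is `Õ(n / m)`
    ∃ (C : ℝ) (K : ℕ) (S : ℕ → ℕ → ℕ),
    (∀ n m : ℕ, (S n m : ℝ) ≤ MPC.softBound C K n m) ∧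
    ∀ (δ : ℝ), 0 < δ → δ < 1 → ∀ (c : ℕ), ∃ n₀ : ℕ, ∀ (n m : ℕ), n₀ ≤ n →
    (n : ℝ) ^ δ ≤ (m : ℝ) → (m : ℝ) ≤ MPC.softBound C₀ K₀ n m →
    ∀ (T : NumberedTree n) (part : Fin m → List (Fin n)), MPC.IsDistribution part →
    (∀ μ, ((part μ).length : ℝ) ≤ MPC.softBound C₀ K₀ n m) →
    ∃ run : MPC.Tapes m (MPC.wordLength κ n) → ℕ → Fin m → MPC.State,
      (∀ ω, MPC.IsRun n A (MPC.treeInput T part) ω (run ω) ∧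
        MPC.OutputsDegrees T (run ω R)) ∧
      MPC.coins m (MPC.wordLength κ n)
        {ω | ¬ ∀ (i : Fin R) (μ : Fin m),
          MPC.spaceUsed (MPC.treeInput T part) (run ω) i μ ≤ S n m ∧
          MPC.timeUsed (run ω) i μ ≤ a * S n m} ≤ ((n : ENNReal) ^ c)⁻¹ := by
  refine ⟨5, 8, 1, MPC.degreeAlgorithm, fun C₀ K₀ => ⟨1000 * (|C₀| + 1), K₀,
    fun n m => ⌊MPC.softBound (1000 * (|C₀| + 1)) K₀ n m⌋₊, ?_, ?_⟩⟩
  · intro n m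
    refine Nat.floor_le ?_
    have := Real.log_natCast_nonneg n
    unfold MPC.softBound
    positivity
  intro δ _ _ c
  obtain ⟨n₁, hn₁⟩ := MPC.eventually_log_pow_le (|C₀| + 1) (by positivity) K₀
  refine ⟨max n₁ 3, fun n m hn hmδ hmC T part hpart hlen => ?_⟩
  have hn3 : 3 ≤ n := (le_max_right _ _).trans hn
  have hnpos : (0 : ℝ) < n := by
    have : 0 < n := by omega
    exact_mod_cast this
  have hmpos : (0 : ℝ) < m := (Real.rpow_pos_of_pos hnpos δ).trans_le hmδ
  have hm0 : 0 < m := by exact_mod_cast hmpos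
  have hm1 : (1 : ℝ) ≤ m := by exact_mod_cast hm0
  have hlog1 := MPC.one_le_log hn3
  have hlogK : 1 ≤ Real.log n ^ K₀ := one_le_pow₀ hlog1
  set Y : ℝ := (n : ℝ) / m * Real.log n ^ K₀ with hY
  have hX : MPC.softBound C₀ K₀ n m = C₀ * Y := by rw [MPC.softBound, hY, mul_assoc]
  have hYpos : 0 < Y := by positivity
  have hXY : C₀ * Y ≤ |C₀| * Y := mul_le_mul_of_nonneg_right (le_abs_self _) hYpos.le
  rw [hX] at hmC hlen
  have hnmY : (n : ℝ) / m ≤ Y := le_mul_of_one_le_right (by positivity) hlogK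
  -- If `m > n`, then `n / m ≤ 1` and the assumed bound on `m` is only polylogarithmic, hence below
  -- `n` for large `n`.
  have hmn : m ≤ n := by
    by_contra hcon
    push Not at hcon
    have h1 : (n : ℝ) < m := by exact_mod_cast hcon
    have h2 : (n : ℝ) / m ≤ 1 := (div_le_one hmpos).2 h1.le
    have h3 : Y ≤ Real.log n ^ K₀ := mul_le_of_le_one_left (by positivity) h2
    have h4 : |C₀| * Y ≤ |C₀| * Real.log n ^ K₀ := mul_le_mul_of_nonneg_left h3 (abs_nonneg _)
    have h5 := hn₁ n ((le_max_left _ _).trans hn)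
    linarith
  set U := MPC.loadBound n m ⌊C₀ * Y⌋₊ with hU
  have hrun := MPC.exists_run (U := U) T hpart hm0 (fun μ => by
      have h1 := hpart.length_le μ
      have h2 := Nat.le_floor (hlen μ)
      have h3 := (MPC.le_loadBound n m ⌊C₀ * Y⌋₊).1
      omega)
    (MPC.le_loadBound n m _).2.1 (MPC.le_loadBound n m _).2.2
    (MPC.loadBound_lt_two_pow hn3 hmn)
  choose run hrun1 hrun2 hrun3 using hrun
  -- Here `U ≤ 2 * C₀ * Y + 4 * Y + 2 * m + 1`. The bounds `m ≤ C₀ * Y` and `1 ≤ m` absorb the last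
  -- terms and the additive constant, so the factor `1000 * (|C₀| + 1)` suffices.
  have hUS : 100 * U + 100 ≤ ⌊MPC.softBound (1000 * (|C₀| + 1)) K₀ n m⌋₊ := by
    refine Nat.le_floor ?_
    rw [MPC.softBound, mul_assoc, ← hY]
    have h1 : ((⌊C₀ * Y⌋₊ : ℕ) : ℝ) ≤ C₀ * Y := Nat.floor_le (hmpos.le.trans hmC)
    have h2 : U ≤ 2 * ⌊C₀ * Y⌋₊ + (3 * n / m + m) + m + n / m + 1 := by
      have := MPC.blockLength_le n m
      rw [hU, MPC.loadBound]
      omega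
    have h3 : (U : ℝ) ≤
        2 * (⌊C₀ * Y⌋₊ : ℝ) + ((3 * n / m : ℕ) + m) + m + (n / m : ℕ) + 1 := by exact_mod_cast h2
    have h4 : ((3 * n / m : ℕ) : ℝ) ≤ 3 * (n / m : ℝ) := by
      refine Nat.cast_div_le.trans (le_of_eq ?_)
      push_cast
      ring
    have h5 : ((n / m : ℕ) : ℝ) ≤ n / m := Nat.cast_div_le
    push_cast
    nlinarith
  refine ⟨run, fun ω => ⟨hrun1 ω, hrun2 ω⟩, ?_⟩
  -- The resource bounds hold for every outcome of the random words.
  have hempty : {ω | ¬ ∀ (i : Fin 5) (μ : Fin m),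
      MPC.spaceUsed (MPC.treeInput T part) (run ω) i μ ≤
        ⌊MPC.softBound (1000 * (|C₀| + 1)) K₀ n m⌋₊ ∧
      MPC.timeUsed (run ω) i μ ≤ 1 * ⌊MPC.softBound (1000 * (|C₀| + 1)) K₀ n m⌋₊} = ∅ := by
    refine Set.eq_empty_iff_forall_notMem.2 fun ω hω => hω fun i μ => ?_
    have := hrun3 ω i μ
    exact ⟨this.1.trans hUS, by rw [one_mul]; exact this.2.trans hUS⟩
  rw [hempty, MeasureTheory.measure_empty]
  exact zero_le
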